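/- Let $D$ be a non-principal ultrafilter on the set $P$ of prime numbers, and let ${}^*\mathbb Z=\mathbb Z^P/D$, ${}^*\mathbb R=\mathbb R^P/D$, ${}^*\mathbb C=\mathbb C^P/D$. Let $\mathfrak p\in{}^*\mathbb Z$ be a nonstandard prime, $\mathrm F_{\mathfrak p}={}^*\mathbb Z/\mathfrak p$ the corresponding pseudo-finite field, and write $\hat z\in \mathrm F_{\mathfrak p}$ for the class of $z\in{}^*\mathbb Z$. Let $\epsilon\in \mathrm F_{\mathfrak p}$ (identified with its representative in $(0,\mathfrak p)$) and $\mathbf i,\mathbf j,\mathfrak m,\mathfrak l\in{}^*\mathbb Z$, let $\Omega=\{\mathfrak p,\epsilon,\mathbf i\}$, and let $\mathcal F$ be the set of functions $f:{}^*\mathbb Z\to{}^*\mathbb Z$ definable in $({}^*\mathbb Z;+,\cdot,\Omega)$ with $f(\mathbb N)\subseteq\mathbb N$. Assume: 1. $\epsilon^\eta=1$ in $\mathrm F_{\mathfrak p}$ if and only if $(\mathfrak p-1)\mid\eta$; write $\exp_{\mathfrak p}(\eta)=\epsilon^\eta$ for $\eta\in{}^*\mathbb Z$. 2. $n\mid\mathfrak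 m$ for every standard $n\ge 1$, $\mathfrak m^2=\mathfrak l$, $\mathfrak m\mid\mathbf j$, $\mathbf j^2=\mathbf i$, $\mathbf i\mid \mathfrak p-1$ and $\mathbf i\,\mathfrak l\mid\mathfrak p-1$; put $\mathfrak u=\frac{\mathfrak p-1}{\mathbf i\mathfrak l}$ and $\mathfrak v=\mathbf i\mathfrak u=\frac{\mathfrak p-1}{\mathfrak l}$. 3. $\epsilon^{(\mathfrak p-1)/\mathbf i}$ is not algebraic over the subfield of $\mathrm F_{\mathfrak p}$ generated by $\hat{\mathbf i}$. 4. $\mathfrak l$ is finite-generic: every formula $\Phi(x)$ of $({}^*\mathbb Z;+,\cdot,\Omega)$ that holds at all $n\in\mathbb N$ holds at $\mathfrak l$. 5. If $\mathbf i^2\ne\mathfrak p-1$, then for all $f\in\mathcal F$, $k\in\mathbb N$ and $a_0,\dots,a_k\in{}^*\mathbb Z$ with $|a_t|\le f(\mathfrak l)$ and $a_0\neq0$, one has $a_0\mathbf i^k+a_1\mathbf i^{k-1}+\dots+a_k\not\equiv0 \bmod \mathfrak p$. If $\mathbf i^2=\mathfrak p-1$, then $\epsilon$ is normalised so that $\epsilon^{(\mathfrak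 p-1)/8}=\hat{\mathbf j}^{-1}$. 6. $\pi'\in{}^*\mathbb R$ is such that $\mathrm e^{\pi'}$ is transcendental in the sense of the ultrapower, i.e. $\pi'$ is represented by $(\pi'_q)_{q\in P}$ with $\mathrm e^{\pi'_q}$ transcendental over $\mathbb Q$ for $D$-almost all $q$. Let $\mathrm O(\mathcal F)=\{z\in{}^*\mathbb Z:\ |z|\le f(\mathfrak l)\text{ for some }f\in\mathcal F\}$ and $\mathrm O(\mathfrak l)=\{z\in{}^*\mathbb Z:\ |z|\le n\mathfrak l\text{ for some }n\in\mathbb N\}$. Let $\mathrm O(\mathrm F)\subseteq \mathrm F_{\mathfrak p}$ be the set of all internal sums $$\sum_{t\in I}a_t\exp_{\mathfrak p}(r_t\mathfrak u)\exp_{\mathfrak p}(s_t\mathfrak v),$$ where $I\subseteq[0,\mathfrak l^M]$ is an internal subset of ${}^*\mathbb Z$, $M\in\mathbb N$, and $(a_t)_{t\in I}$, $(r_t)_{t\in I}$, $(s_t)_{t\in I}$ are internal sequences with $a_t\in \mathrm O(\mathcal F)$ and $r_t,s_t\in\mathrm O(\mathfrak l)$; and let $\mathrm F\subseteq \mathrm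 F_{\mathfrak p}$ be its field of fractions. Let $\mathrm{st}:{}^*\mathbb C\to\mathbb C\cup\{\infty\}$ be the standard part map, with value $\infty$ at the infinite elements. Then there is a unique field embedding $\mathrm I_{\mathrm F}:\mathrm F\to{}^*\mathbb C$ such that $$\mathrm I_{\mathrm F}\Big(\sum_{t\in I}a_t\exp_{\mathfrak p}(r_t\mathfrak u)\exp_{\mathfrak p}(s_t\mathfrak v)\Big)=\sum_{t\in I}a_t\,\mathrm e^{-2r_t\pi'/\mathfrak l}\,\mathrm e^{-2s_t\pi i/\mathfrak l}$$ for all such sums. Moreover, for some $\mathrm i'\in{}^*\mathbb C$ such that $\mathrm i'-\sqrt{-1}$ is infinitesimal, $\mathrm I_{\mathrm F}$ extends to a field embedding $\mathrm I_{\mathrm F}:\mathrm F_{\mathfrak p}\to{}^*\mathbb C$ with $\mathrm I_{\mathrm F}(\hat{\mathbf i})=\mathrm i'$, which can be taken such that $\mathsf{lm}_{\mathrm F}:=\mathrm{st}\circ\mathrm I_{\mathrm F}$ is a surjective place from $\mathrm F_{\mathfrak p}$ onto $\mathbb C\cup\{\infty\}$ (a ring homomorphism from a valuation ring of $\mathrm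 F_{\mathfrak p}$ onto $\mathbb C$, with value $\infty$ outside that ring) with $$\mathsf{lm}_{\mathrm F}(\hat{\mathbf i})=\mathrm e^{\pi i/2},\qquad \mathsf{lm}_{\mathrm F}(\hat{\mathbf j})=\mathrm e^{\pi i/4}.$$ -/

import Mathlib

open Filter Topology

noncomputable section

namespace PseudoFinite

/-- The ultrapower `*ℤ` over an ultrafilter on the set of prime numbers. -/
abbrev StarZ (D : Ultrafilter Nat.Primes) : Type := (D : Filter Nat.Primes).Germ ℤ

/-- The ultrapower `*ℂ`. -/
abbrev StarC (D : Ultrafilter Nat.Primes) : Type := (D : Filter Nat.Primes).Germ ℂ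

/-- The element of `*ℤ` represented by a sequence of integers. -/
abbrev starZ (D : Ultrafilter Nat.Primes) (x : Nat.Primes → ℤ) : StarZ D := Germ.ofFun x

/-- The element of `*ℂ` represented by a sequence of complex numbers. -/
abbrev starC (D : Ultrafilter Nat.Primes) (x : Nat.Primes → ℂ) : StarC D := Germ.ofFun x

/-- The standard complex number `z` as an element of `*ℂ`. -/
abbrev stdC (D : Ultrafilter Nat.Primes) (z : ℂ) : StarC D := starC D fun _ => z

/-! ### Infinitesimals, standard part, places -/

/-- `z ∈ *ℂ` is infinitesimal: `|z| < δ` for every standard real `δ > 0`. -/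
def Infinitesimal {D : Ultrafilter Nat.Primes} (z : StarC D) : Prop :=
  ∀ δ : ℝ, 0 < δ → Germ.LiftPred (fun w : ℂ => ‖w‖ < δ) z

open Classical in
/-- The standard part map `*ℂ → ℂ ∪ {∞}`: the standard complex number infinitesimally close
to `z` if there is one, and `∞` otherwise (i.e. when `z` is infinite). -/
def st {D : Ultrafilter Nat.Primes} (z : StarC D) : OnePoint ℂ :=
  if h : ∃ c : ℂ, Infinitesimal (z - stdC D c) then ((h.choose : ℂ) : OnePoint ℂ) else OnePoint.infty

/-- A place of the field `K` onto `ℂ ∪ {∞}`: a surjective homomorphism from a valuation ring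
of `K` onto `ℂ`, extended by `∞` outside of the valuation ring. -/
def IsPlace {K : Type*} [Field K] (f : K → OnePoint ℂ) : Prop :=
  ∃ (V : ValuationSubring K) (ρ : V →+* ℂ), Function.Surjective ρ ∧
    (∀ x : V, f x = ((ρ x : ℂ) : OnePoint ℂ)) ∧ ∀ x : K, x ∉ V → f x = OnePoint.infty

/-! ### Definability in nonstandard arithmetic -/

/-- `*ℤ` as a first-order structure in the language of rings. -/
instance instCompatibleRingStarZ (D : Ultrafilter Nat.Primes) :
    FirstOrder.Ring.CompatibleRing (StarZ D) :=
  FirstOrder.Ring.compatibleRingOfRing (StarZ D)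

/-- The parameters: sequences representing the nonstandard prime `p`, the integer `e`
representing `ε ∈ *ℤ / p`, the nonstandard integers `i`, `j`, `m`, `l`, `u`, and the
nonstandard real number `ϖ` (the number `π'`). -/
structure Params (D : Ultrafilter Nat.Primes) where
  p : Nat.Primes → ℤ
  e : Nat.Primes → ℤ
  i : Nat.Primes → ℤ
  j : Nat.Primes → ℤ
  m : Nat.Primes → ℤ
  l : Nat.Primes → ℤ
  u : Nat.Primes → ℤ
  ϖ : Nat.Primes → ℝ
  prime : Prime (starZ D p)

/-- An ideal generated by a prime element of `*ℤ` is maximal. -/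
theorem isMaximal_span_of_prime {D : Ultrafilter Nat.Primes} {q : StarZ D} (hq : Prime q) :
    (Ideal.span {q}).IsMaximal := by
  have key : ∀ x y : StarZ D, ∃ g a b c d : StarZ D, x = g * c ∧ y = g * d ∧
      g = x * a + y * b := by
    intro x y
    induction x using Germ.inductionOn with | _ x => ?_
    induction y using Germ.inductionOn with | _ y => ?_
    refine ⟨((fun k => ((Int.gcd (x k) (y k) : ℕ) : ℤ) : Nat.Primes → ℤ) : StarZ D),
      ((fun k => Int.gcdA (x k) (y k) : Nat.Primes → ℤ) : StarZ D),
      ((fun k => Int.gcdB (x k) (y k) : Nat.Primes → ℤ) : StarZ D),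
      ((fun k => x k / (Int.gcd (x k) (y k) : ℕ) : Nat.Primes → ℤ) : StarZ D),
      ((fun k => y k / (Int.gcd (x k) (y k) : ℕ) : Nat.Primes → ℤ) : StarZ D), ?_, ?_, ?_⟩
    · exact congrArg _ (funext fun k =>
        (Int.mul_ediv_cancel' (Int.gcd_dvd_left (x k) (y k))).symm)
    · exact congrArg _ (funext fun k =>
        (Int.mul_ediv_cancel' (Int.gcd_dvd_right (x k) (y k))).symm)
    · exact congrArg _ (funext fun k => Int.gcd_eq_gcd_ab (x k) (y k))
  rw [Ideal.isMaximal_iff]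
  refine ⟨?_, ?_⟩
  · rw [Ideal.mem_span_singleton]
    exact fun h => hq.not_isUnit (isUnit_of_dvd_one h)
  · intro J x hJ hx hxJ
    rw [Ideal.mem_span_singleton] at hx
    have hqJ : q ∈ J := hJ (Ideal.mem_span_singleton_self q)
    obtain ⟨g, a, b, c, d, h1, h2, h3⟩ := key x q
    have hgJ : g ∈ J := by
      rw [h3]
      exact J.add_mem (J.mul_mem_right _ hxJ) (J.mul_mem_right _ hqJ)
    rcases hq.irreducible.isUnit_or_isUnit h2 with h | h
    · have := J.eq_top_of_isUnit_mem hgJ h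
      rw [this]; trivial
    · exfalso
      apply hx
      obtain ⟨d', rfl⟩ := h
      refine ⟨(↑d'⁻¹ : StarZ D) * c, ?_⟩
      rw [h2, h1, mul_assoc, Units.mul_inv_cancel_left]

namespace Params

variable {D : Ultrafilter Nat.Primes} (P : Params D)

/-- The pseudo-finite field `*ℤ / p`. -/
def Fp : Type := StarZ D ⧸ Ideal.span {starZ D P.p}

instance instFieldFp : Field P.Fp :=
  letI := isMaximal_span_of_prime P.prime
  Ideal.Quotient.field (Ideal.span {starZ D P.p})

/-- Reduction modulo `p` of the nonstandard integer represented by the sequence `x`. -/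
def red (x : Nat.Primes → ℤ) : P.Fp := Ideal.Quotient.mk (Ideal.span {starZ D P.p}) (starZ D x)

/-- The set of parameters `Ω = {p, ε, i}`. -/
def Ω : Set (StarZ D) := {starZ D P.p, starZ D P.e, starZ D P.i}

/-- A tuple `L` of nonstandard integers is finite-generic if every formula of the structure
`(*ℤ; Ω)` that holds at all tuples of standard natural numbers holds at `L`. -/
def FiniteGeneric {k : ℕ} (L : Fin k → StarZ D) : Prop :=
  ∀ S : Set (Fin k → StarZ D), P.Ω.Definable FirstOrder.Language.ring S →
    (∀ n : Fin k → ℕ, (fun t => (n t : StarZ D)) ∈ S) → L ∈ S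

/-- The set `ℱ` of all functions `*ℤ → *ℤ` definable in `(*ℤ; Ω)` that map `ℕ` to `ℕ`. -/
def funs : Set (StarZ D → StarZ D) :=
  {f | P.Ω.Definable₂ FirstOrder.Language.ring {xy : StarZ D × StarZ D | xy.2 = f xy.1} ∧
    ∀ n : ℕ, ∃ k : ℕ, f n = k}

/-- `O(ℱ)`: the union of the intervals `[-f(l), f(l)]` of `*ℤ`, for `f ∈ ℱ`. -/
def OFun : Set (StarZ D) :=
  {z | ∃ f ∈ P.funs, -f (starZ D P.l) ≤ z ∧ z ≤ f (starZ D P.l)}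

/-- `O(l)`: the union of the intervals `[-n l, n l]` of `*ℤ`, for standard `n`. -/
def OL : Set (StarZ D) :=
  {z | ∃ n : ℕ, -((n : StarZ D) * starZ D P.l) ≤ z ∧ z ≤ (n : StarZ D) * starZ D P.l}

/-! ### The exponential map -/

/-- Coordinates of `ε ^ η` for a nonstandard integer exponent `η`: since `ε ^ (p - 1) = 1`,
the exponent (possibly negative) is first reduced modulo `p - 1`. -/
def expCoord (η : Nat.Primes → ℤ) (k : Nat.Primes) : ℤ := P.e k ^ (η k % (P.p k - 1)).toNat

/-- `exp_p(η) = ε ^ η ∈ F_p`. -/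
def expP (η : Nat.Primes → ℤ) : P.Fp := P.red (P.expCoord η)

/-- The element `v = i u`. -/
def v (k : Nat.Primes) : ℤ := P.i k * P.u k

/-- The field-theoretic algebraic closure of `X` inside `F_p`. -/
def acl (X : Set P.Fp) : Set P.Fp := {x | IsAlgebraic (Subfield.closure X) x}

/-- The standing choice of the parameters. -/
structure Admissible : Prop where
  /-- `ε` is represented by `0 < e < p`. -/
  e_pos : 0 < starZ D P.e
  e_lt : starZ D P.e < starZ D P.p
  /-- `ε ^ η = 1` in `F_p` iff `p - 1` divides `η`. -/
  exp_eq_one : ∀ η : Nat.Primes → ℕ,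
    P.red (fun k => P.e k ^ η k) = 1 ↔ starZ D P.p - 1 ∣ starZ D fun k => (η k : ℤ)
  /-- `n ∣ m` for every standard `n ≥ 1`, `m ^ 2 = l`, `m ∣ j`, `j ^ 2 = i`, `i ∣ p - 1`. -/
  dvd_m : ∀ n : ℕ, 0 < n → (n : StarZ D) ∣ starZ D P.m
  m_sq : starZ D P.m ^ 2 = starZ D P.l
  m_dvd : starZ D P.m ∣ starZ D P.j
  j_sq : starZ D P.j ^ 2 = starZ D P.i
  i_dvd : starZ D P.i ∣ starZ D P.p - 1
  /-- `u = (p - 1) / (i l)`. -/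
  u_eq : starZ D P.u * (starZ D P.i * starZ D P.l) = starZ D P.p - 1
  /-- `α = exp_p(l u) = ε ^ ((p - 1) / i)` is transcendental over `i mod p`. -/
  alpha : P.expP (fun k => P.l k * P.u k) ∉ P.acl {P.red P.i}
  /-- `l` is finite-generic. -/
  generic : P.FiniteGeneric ![starZ D P.l]
  /-- If `i ^ 2 ≠ p - 1`, then `i mod p` is not a zero of a polynomial of standard degree whose
  coefficients are bounded by `f(l)`, `f ∈ ℱ`, and whose leading coefficient is nonzero. -/
  i_generic : starZ D P.i ^ 2 + 1 ≠ starZ D P.p →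
    ∀ f ∈ P.funs, ∀ (k : ℕ) (a : Fin (k + 1) → Nat.Primes → ℤ),
      (∀ t, -f (starZ D P.l) ≤ starZ D (a t) ∧ starZ D (a t) ≤ f (starZ D P.l)) →
      starZ D (a 0) ≠ 0 → ∑ t : Fin (k + 1), P.red (a t) * P.red P.i ^ (k - (t : ℕ)) ≠ 0
  /-- If `i ^ 2 = p - 1`, so that `j mod p` is a root of unity of order `8`, then the primitive
  root `ε` is normalised by `ε ^ ((p - 1) / 8) = j⁻¹`. -/
  normal : starZ D P.i ^ 2 + 1 = starZ D P.p →
    ∀ w : Nat.Primes → ℤ, 8 * starZ D w = starZ D P.p - 1 → P.expP w * P.red P.j = 1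
  /-- `exp(π')` is a transcendental real number, in the sense of the ultrapower. -/
  transc : ∀ᶠ k in (D : Filter Nat.Primes), Transcendental ℚ (Real.exp (P.ϖ k))

end Params

/-! ### The fields and the embedding `I_F` -/

/-- An internal finite family of triples `(a_t, r_t, s_t)`, `t ∈ I`, of nonstandard integers:
the ultraproduct of a sequence of finite families of triples of integers. -/
structure Family where
  I : Nat.Primes → Finset ℤ
  a : Nat.Primes → ℤ → ℤ
  r : Nat.Primes → ℤ → ℤ
  s : Nat.Primes → ℤ → ℤ

namespace Params

variable {D : Ultrafilter Nat.Primes} (P : Params D)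

/-- `I ⊆ [0, l ^ M]` for some standard `M`, and for all `t` in the internal set `I`:
`a_t ∈ O(ℱ)`, `r_t ∈ O(l)`, `s_t ∈ O(l)`. -/
def Good (A : Family) : Prop :=
  (∃ M : ℕ, ∀ᶠ k in (D : Filter Nat.Primes), A.I k ⊆ Finset.Icc 0 (P.l k ^ M)) ∧
  ∀ t : Nat.Primes → ℤ, (∀ᶠ k in (D : Filter Nat.Primes), t k ∈ A.I k) →
    starZ D (fun k => A.a k (t k)) ∈ P.OFun ∧ starZ D (fun k => A.r k (t k)) ∈ P.OL ∧
      starZ D (fun k => A.s k (t k)) ∈ P.OL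

/-- The internal sum of `a_t exp_p(r_t u) exp_p(s_t v)` over `t ∈ I`, in `F_p`. -/
def sumF (A : Family) : P.Fp :=
  P.red fun k => ∑ t ∈ A.I k, A.a k t * P.expCoord (fun k' => A.r k' t * P.u k') k *
    P.expCoord (fun k' => A.s k' t * P.v k') k

/-- The internal sum of `a_t exp(-2 r_t π' / l) exp(-2 s_t π i / l)` over `t ∈ I`, in `*ℂ`. -/
def sumC (A : Family) : StarC D :=
  starC D fun k => ∑ t ∈ A.I k, (A.a k t : ℂ) *
    Complex.exp (-(2 * (A.r k t : ℂ) * (P.ϖ k : ℂ) / (P.l k : ℂ))) *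
    Complex.exp (-(2 * (A.s k t : ℂ) * (Real.pi : ℂ) * Complex.I / (P.l k : ℂ)))

/-- The ring `O(F) ⊆ F_p`. -/
def OF : Set P.Fp := {x | ∃ A : Family, P.Good A ∧ P.sumF A = x}

/-- The field `F ⊆ F_p` of fractions of `O(F)`. -/
def F : Subfield P.Fp := Subfield.closure P.OF

theorem sumF_mem (A : Family) (hA : P.Good A) : P.sumF A ∈ P.F :=
  Subfield.subset_closure ⟨A, hA, rfl⟩

/-- `I` is the embedding `I_F : F → *ℂ`, given on `O(F)` by
`∑ a_t exp_p(r_t u) exp_p(s_t v) ↦ ∑ a_t exp(-2 r_t π' / l) exp(-2 s_t π i / l)`. -/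
def IsEmbeddingIF (I : P.F →+* StarC D) : Prop :=
  ∀ (A : Family) (hA : P.Good A), I ⟨P.sumF A, P.sumF_mem A hA⟩ = P.sumC A

end Params

end PseudoFinite

end

namespace PseudoFinite

/-! ### Arithmetical relations on the integers -/

/-! After multiplication by some `exp_p(n l u)`, an element of `O(F)` is the value `Q(ε^v, ε^u)` of
an internal integer polynomial in two variables whose degrees are `O(l)` and whose coefficients sum
in absolute value to at most `f(l)`, `f ∈ ℱ`. The proposed image is, up to the matching factor,
`Q(ζ, E)` with `ζ = exp(-2πi/l)` and `E = exp(-2π'/l)`. Everything about `I_F` follows from one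
equivalence: `Q(ε^v, ε^u) = 0` in `F_p` iff `Q(ζ, E) = 0` in `*ℂ`
(`evalF_eq_zero_iff_evalC_eq_zero`). The two value rings are then isomorphic, and so are their
fraction fields.

Over `*ℂ`, `E` is transcendental and `ζ` algebraic at almost every coordinate, so `Q(ζ, E) = 0` iff
every coefficient `Q_r(ζ)` vanishes. The same splitting in `F_p` comes from genericity. If `l` is
replaced by a standard `n`, then `ε^u` becomes an `n`-th root of the transcendental `α` and `ε^v` an
`n`-th root of unity, so a relation with standard coefficients splits (`noRelation_standard`). This
is an arithmetical statement about `n` and a coefficient bound, so it passes to `l` and `f(l)`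
(`generic_transfer`, `dvd_of_sum_evalF_eq_zero`). It remains to compare `Q_r(ε^v)` with `Q_r(ζ)`,
both at primitive `l`-th roots of unity. The resultant of `Q_r` with the cyclotomic polynomial is at
most `size^l` in absolute value, and `size^l < p` by genericity once more, so vanishing modulo `p`
and vanishing in `ℂ` agree.

For the extension to `F_p`: `I_F` takes values in the ultrapower of a countable field `K ⊆ ℂ`. A
family of continuum many complex numbers independent over `K` stays independent over `*K`, while
`F_p` has cardinality at most the continuum. So a transcendence basis of `F_p` over `F` has room to
go to such numbers, and `*ℂ` is algebraically closed (`exists_extension_starC`). If `i² ≠ p - 1`,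
then `j` is transcendental over `F` and can be placed in the basis with a value infinitely close to
`e^{πi/4}`. Otherwise the normalisation puts `j` in `F` with value exactly `e^{πi/4}`. The standard
part map is a place on any subfield of `*ℂ` that meets every monad of a complex number, and the
image of `F` already does. -/

instance instCompatibleRingInt : FirstOrder.Ring.CompatibleRing ℤ :=
  FirstOrder.Ring.compatibleRingOfRing ℤ

/-- A relation between the entries of a stream of integers is arithmetical if it is given by a
first-order formula of the language of rings. -/
def Arith (R : (ℕ → ℤ) → Prop) : Prop :=
  ∃ φ : FirstOrder.Language.ring.Formula ℕ, ∀ v, φ.Realize v ↔ R v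

/-- A function of the entries of a stream of integers is arithmetical if its graph is. -/
def ArithFun (f : (ℕ → ℤ) → ℤ) : Prop :=
  Arith fun v => v 0 = f fun n => v (n + 1)

namespace Arith

variable {R S : (ℕ → ℤ) → Prop}

theorem congr (h : Arith R) (hRS : ∀ v, R v ↔ S v) : Arith S := by
  obtain ⟨φ, hφ⟩ := h
  exact ⟨φ, fun v => (hφ v).trans (hRS v)⟩

theorem not (h : Arith R) : Arith fun v => ¬R v := by
  obtain ⟨φ, hφ⟩ := h
  exact ⟨φ.not, fun v => by rw [FirstOrder.Language.Formula.realize_not, hφ]⟩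

theorem and (h : Arith R) (h' : Arith S) : Arith fun v => R v ∧ S v := by
  obtain ⟨φ, hφ⟩ := h
  obtain ⟨ψ, hψ⟩ := h'
  exact ⟨φ ⊓ ψ, fun v => by rw [FirstOrder.Language.Formula.realize_inf, hφ, hψ]⟩

theorem or (h : Arith R) (h' : Arith S) : Arith fun v => R v ∨ S v :=
  (h.not.and h'.not).not.congr fun v => by tauto

theorem imp (h : Arith R) (h' : Arith S) : Arith fun v => R v → S v :=
  (h.and h'.not).not.congr fun v => by tauto

/-- Streams serve as de Bruijn contexts: a quantifier binds entry 0 and the free entries move up by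
one. -/
theorem exists' {R : ℤ → (ℕ → ℤ) → Prop}
    (h : Arith fun v => R (v 0) fun n => v (n + 1)) : Arith fun v => ∃ x, R x v := by
  obtain ⟨φ, hφ⟩ := h
  refine ⟨(φ.relabel (fun n : ℕ => match n with
    | 0 => (Sum.inr 0 : ℕ ⊕ Fin 1)
    | n + 1 => Sum.inl n)).iExs (Fin 1), fun v => ?_⟩
  rw [FirstOrder.Language.Formula.realize_iExs]
  simp only [FirstOrder.Language.Formula.realize_relabel, hφ]
  constructor
  · rintro ⟨i, hi⟩
    exact ⟨i 0, hi⟩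
  · rintro ⟨x, hx⟩
    exact ⟨fun _ => x, hx⟩

theorem forall' {R : ℤ → (ℕ → ℤ) → Prop}
    (h : Arith fun v => R (v 0) fun n => v (n + 1)) : Arith fun v => ∀ x, R x v :=
  (exists' (R := fun x v => ¬R x v) h.not).not.congr fun v => by simp

theorem subst (h : Arith R) (σ : ℕ → ℕ) : Arith fun v => R fun n => v (σ n) := by
  obtain ⟨φ, hφ⟩ := h
  exact ⟨φ.relabel σ, fun v => by rw [FirstOrder.Language.Formula.realize_relabel, hφ]; rfl⟩

/-- Only the graph of `f` is a formula, so its value is named by an existential quantifier. -/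
theorem comp {R : ℤ → (ℕ → ℤ) → Prop} {f : (ℕ → ℤ) → ℤ}
    (h : Arith fun v => R (v 0) fun n => v (n + 1)) (hf : ArithFun f) : Arith fun v => R (f v) v :=
  (exists' (R := fun x v => x = f v ∧ R x v) (hf.and h)).congr fun v => by simp

end Arith

namespace ArithFun

variable {f g : (ℕ → ℤ) → ℤ}

theorem var (n : ℕ) : ArithFun fun v => v n :=
  ⟨FirstOrder.Language.Term.equal (FirstOrder.Language.Term.var 0)
    (FirstOrder.Language.Term.var (n + 1)), fun v => by simp⟩

theorem subst (hf : ArithFun f) (σ : ℕ → ℕ) : ArithFun fun v => f fun n => v (σ n) :=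
  Arith.subst hf fun n => match n with
    | 0 => 0
    | n + 1 => σ n + 1

theorem comp {f : ℤ → (ℕ → ℤ) → ℤ} {g : (ℕ → ℤ) → ℤ}
    (hf : ArithFun fun v => f (v 0) fun n => v (n + 1)) (hg : ArithFun g) :
    ArithFun fun v => f (g v) v := by
  refine Arith.comp (R := fun x v => v 0 = f x fun n => v (n + 1)) ?_ (hg.subst fun n => n + 1)
  -- Entry 0 now holds the intermediate value and entry 1 the output, so these two entries trade
  -- places.
  exact Arith.subst hf fun n => match n with
    | 0 => 1
    | 1 => 0
    | n + 2 => n + 2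

theorem of_exists_unique {f : (ℕ → ℤ) → ℤ} (R : ℤ → (ℕ → ℤ) → Prop)
    (h : Arith fun v => R (v 0) fun n => v (n + 1)) (hR : ∀ x v, R x v ↔ x = f v) : ArithFun f :=
  h.congr fun _ => hR _ _

theorem zero : ArithFun fun _ => 0 :=
  ⟨FirstOrder.Language.Term.equal (FirstOrder.Language.Term.var 0) 0, fun v => by simp⟩

theorem one : ArithFun fun _ => 1 :=
  ⟨FirstOrder.Language.Term.equal (FirstOrder.Language.Term.var 0) 1, fun v => by simp⟩

theorem comp₂ {op : ℤ → ℤ → ℤ} (h : ArithFun fun v => op (v 0) (v 1)) (hf : ArithFun f)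
    (hg : ArithFun g) : ArithFun fun v => op (f v) (g v) :=
  comp (f := fun x v => op x (g v))
    (comp (f := fun x v => op (v 0) x)
      (h.subst fun n => match n with
        | 0 => 1
        | _ + 1 => 0) (hg.subst fun n => n + 1)) hf

theorem add (hf : ArithFun f) (hg : ArithFun g) : ArithFun fun v => f v + g v :=
  comp₂ ⟨FirstOrder.Language.Term.equal (FirstOrder.Language.Term.var 0)
      (FirstOrder.Language.Term.var 1 + FirstOrder.Language.Term.var 2), fun v => by simp⟩ hf hg

theorem mul (hf : ArithFun f) (hg : ArithFun g) : ArithFun fun v => f v * g v :=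
  comp₂ ⟨FirstOrder.Language.Term.equal (FirstOrder.Language.Term.var 0)
      (FirstOrder.Language.Term.var 1 * FirstOrder.Language.Term.var 2), fun v => by simp⟩ hf hg

theorem neg (hf : ArithFun f) : ArithFun fun v => -f v :=
  comp (f := fun x _ => -x) ⟨FirstOrder.Language.Term.equal (FirstOrder.Language.Term.var 0)
      (-FirstOrder.Language.Term.var 1), fun v => by simp⟩ hf

theorem sub (hf : ArithFun f) (hg : ArithFun g) : ArithFun fun v => f v - g v := by
  simpa only [sub_eq_add_neg] using hf.add hg.neg

theorem natCast (n : ℕ) : ArithFun fun _ => (n : ℤ) := by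
  induction n with
  | zero => simpa using zero
  | succ n ih => simpa using ih.add one

end ArithFun

namespace Arith

variable {f g : (ℕ → ℤ) → ℤ}

theorem comp₂ {R : ℤ → ℤ → Prop} (h : Arith fun v => R (v 0) (v 1)) (hf : ArithFun f)
    (hg : ArithFun g) : Arith fun v => R (f v) (g v) :=
  comp (R := fun x v => R x (g v))
    (comp (R := fun x v => R (v 0) x)
      (h.subst fun n => match n with
        | 0 => 1
        | _ + 1 => 0) (hg.subst fun n => n + 1)) hf

theorem eq (hf : ArithFun f) (hg : ArithFun g) : Arith fun v => f v = g v :=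
  comp₂ ⟨FirstOrder.Language.Term.equal (FirstOrder.Language.Term.var 0)
      (FirstOrder.Language.Term.var 1), fun v => by simp⟩ hf hg

/-- The order is not in the language of rings; Lagrange's four-square theorem defines it. -/
theorem nonneg (hf : ArithFun f) : Arith fun v => 0 ≤ f v := by
  refine comp (R := fun x _ => 0 ≤ x) (congr (R := fun v => ∃ a b c d : ℤ,
    a * a + b * b + (c * c + d * d) = v 0) ?_ fun v => ?_) hf
  · refine exists' <| exists' <| exists' <| exists' <| eq ?_ (ArithFun.var 4)
    exact (((ArithFun.var 3).mul (ArithFun.var 3)).add ((ArithFun.var 2).mul (ArithFun.var 2))).add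
      (((ArithFun.var 1).mul (ArithFun.var 1)).add ((ArithFun.var 0).mul (ArithFun.var 0)))
  · constructor
    · rintro ⟨a, b, c, d, h⟩
      rw [← h]
      have := mul_self_nonneg a
      have := mul_self_nonneg b
      have := mul_self_nonneg c
      have := mul_self_nonneg d
      positivity
    · intro h
      obtain ⟨a, b, c, d, h'⟩ := Nat.sum_four_squares (v 0).toNat
      refine ⟨a, b, c, d, ?_⟩
      have : ((v 0).toNat : ℤ) = v 0 := Int.toNat_of_nonneg h
      rw [← this, ← h']
      push_cast
      ring

theorem le (hf : ArithFun f) (hg : ArithFun g) : Arith fun v => f v ≤ g v :=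
  (nonneg (hg.sub hf)).congr fun _ => sub_nonneg

theorem lt (hf : ArithFun f) (hg : ArithFun g) : Arith fun v => f v < g v :=
  (le hg hf).not.congr fun _ => not_le

theorem dvd (hf : ArithFun f) (hg : ArithFun g) : Arith fun v => f v ∣ g v :=
  exists' (R := fun x v => g v = f v * x)
    (eq (hg.subst fun n => n + 1) ((hf.subst fun n => n + 1).mul (ArithFun.var 0)))

end Arith

namespace ArithFun

variable {f g : (ℕ → ℤ) → ℤ}

theorem emod (hf : ArithFun f) (hg : ArithFun g) : ArithFun fun v => f v % g v := by
  -- The remainder by 0 is the dividend itself; otherwise it lies in `[0, |v 1|)`, whatever the sign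
  -- of the divisor.
  refine comp₂ (op := fun x y => x % y) (of_exists_unique (fun y v => (v 1 = 0 ∧ y = v 0) ∨
    (0 ≤ y ∧ (y < v 1 ∨ y < -v 1) ∧ v 1 ∣ v 0 - y)) ?_ fun y v => ?_) hf hg
  · exact ((Arith.eq (var 2) zero).and (.eq (var 0) (var 1))).or
      ((Arith.le zero (var 0)).and (((Arith.lt (var 0) (var 2)).or (.lt (var 0) (var 2).neg)).and
        (.dvd (var 2) ((var 1).sub (var 0)))))
  · generalize v 0 = a
    generalize v 1 = b
    constructor
    · rintro (⟨rfl, rfl⟩ | ⟨h1, h2, h3⟩)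
      · simp
      · have : a % b = y % b :=
          Int.emod_eq_emod_iff_emod_sub_eq_zero.2 (Int.emod_eq_zero_of_dvd h3)
        rw [this]
        rcases h2 with h2 | h2
        · exact (Int.emod_eq_of_lt h1 h2).symm
        · rw [← Int.emod_neg]
          exact (Int.emod_eq_of_lt h1 h2).symm
    · rintro rfl
      rcases eq_or_ne b 0 with rfl | hb
      · simp
      · refine Or.inr ⟨Int.emod_nonneg _ hb, ?_, Int.dvd_self_sub_emod⟩
        have := Int.emod_lt_abs a hb
        rcases abs_choice b with h | h <;> rw [h] at this <;> tauto

theorem toNat (hf : ArithFun f) : ArithFun fun v => ((f v).toNat : ℤ) := by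
  refine comp (f := fun x _ => ((x.toNat : ℕ) : ℤ)) (of_exists_unique (fun y v =>
    (0 ≤ v 0 ∧ y = v 0) ∨ (v 0 < 0 ∧ y = 0)) ?_ fun y v => ?_) hf
  · exact ((Arith.le zero (var 1)).and (.eq (var 0) (var 1))).or
      ((Arith.lt (var 1) zero).and (.eq (var 0) zero))
  · omega

end ArithFun

/-! ### Coding of finite sequences -/

/-- The entry with index `i` of the finite sequence coded by `c`, `d`, `w`. -/
def entry (c d w i : ℤ) : ℤ := c % ((i + 1) * d + 1) - w

/-- Gödel's β function codes sequences of natural numbers. Subtracting the shift `w` extends it to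
integers; `w` is the sum of the absolute values, so every shifted term is nonnegative. -/
theorem exists_entry_eq (a : ℕ → ℤ) (N : ℕ) :
    ∃ c d w, ∀ i < N, entry c d w i = a i := by
  set w : ℕ := ∑ i ∈ Finset.range N, (a i).natAbs with hw
  have hle : ∀ i < N, 0 ≤ a i + w := fun i hi => by
    have : (a i).natAbs ≤ w :=
      Finset.single_le_sum (f := fun i => (a i).natAbs) (fun _ _ => Nat.zero_le _)
        (Finset.mem_range.2 hi)
    omega
  set l : List ℕ := List.ofFn fun i : Fin N => (a i + w).toNat with hl
  refine ⟨(Nat.unbeta l).unpair.1, (Nat.unbeta l).unpair.2, w, fun i hi => ?_⟩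
  have h := Nat.beta_unbeta_coe l ⟨i, by simpa [hl] using hi⟩
  have h' : l[i]'(by simpa [hl] using hi) = (a i + w).toNat := by simp [hl]
  simp only [Nat.beta, Fin.getElem_fin, h'] at h
  have h2 := congrArg (Nat.cast : ℕ → ℤ) h
  rw [Int.toNat_of_nonneg (hle i hi)] at h2
  push_cast at h2
  rw [entry, h2]
  ring

namespace ArithFun

variable {b N : (ℕ → ℤ) → ℤ}

theorem entry {c d w i : (ℕ → ℤ) → ℤ} (hc : ArithFun c) (hd : ArithFun d) (hw : ArithFun w)
    (hi : ArithFun i) : ArithFun fun v => entry (c v) (d v) (w v) (i v) :=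
  (hc.emod (((hi.add one).mul hd).add one)).sub hw

/-- Gödel's definition of recursion: `y` is the last entry of some coded history that starts at `b`
and obeys the step function. This makes sums and powers arithmetical. -/
theorem natRec {s : ℤ → ℤ → (ℕ → ℤ) → ℤ} (hb : ArithFun b)
    (hs : ArithFun fun v => s (v 0) (v 1) fun n => v (n + 2)) (hN : ArithFun N) :
    ArithFun fun v => Nat.rec (motive := fun _ => ℤ) (b v) (fun t x => s t x v) (N v).toNat := by
  refine of_exists_unique (fun y v => ∃ c d w, (PseudoFinite.entry c d w 0 = b v ∧
    ∀ t, 0 ≤ t ∧ t < N v →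
      PseudoFinite.entry c d w (t + 1) = s t (PseudoFinite.entry c d w t) v) ∧
    y = PseudoFinite.entry c d w (N v).toNat) ?_ fun y v => ?_
  · refine .exists' <| .exists' <| .exists' <| .and (.and (.eq (entry (var 2) (var 1) (var 0) zero)
      (hb.subst fun n => n + 4)) <| .forall' <| .imp (.and (.le zero (var 0))
      (.lt (var 0) (hN.subst fun n => n + 5))) <| .eq (entry (var 3) (var 2) (var 1)
      ((var 0).add one)) ?_) (.eq (var 3) (entry (var 2) (var 1) (var 0)
      (hN.subst fun n => n + 4).toNat))
    exact comp (f := fun x v => s (v 0) x (fun n => v (n + 5))) (hs.subst fun n => match n with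
      | 0 => 1
      | 1 => 0
      | n + 2 => n + 6) (entry (var 3) (var 2) (var 1) (var 0))
  · constructor
    · rintro ⟨c, d, w, ⟨h0, h1⟩, rfl⟩
      have key : ∀ n : ℕ, n ≤ (N v).toNat → PseudoFinite.entry c d w n =
          Nat.rec (motive := fun _ => ℤ) (b v) (fun t x => s t x v) n := by
        intro n
        induction n with
        | zero => intro _; simpa using h0
        | succ n ih =>
          intro hn
          have := h1 n (by omega)
          rw [ih (by omega)] at this
          simpa using this
      exact key _ le_rfl
    · rintro rfl
      -- A history of `N` steps has `N + 1` entries.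
      obtain ⟨c, d, w, h⟩ := exists_entry_eq
        (fun n => Nat.rec (motive := fun _ => ℤ) (b v) (fun t x => s t x v) n) ((N v).toNat + 1)
      refine ⟨c, d, w, ⟨h 0 (by omega), ?_⟩, (h _ (by omega)).symm⟩
      rintro t ⟨ht0, htN⟩
      lift t to ℕ using ht0
      rw [h t (by omega)]
      have := h (t + 1) (by omega)
      simpa using this

theorem sum {g : ℤ → (ℕ → ℤ) → ℤ} (hg : ArithFun fun v => g (v 0) fun n => v (n + 1))
    (hN : ArithFun N) : ArithFun fun v => ∑ t ∈ Finset.range (N v).toNat, g t v := by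
  refine (natRec (s := fun t x v => x + g t v) zero ((var 1).add (hg.subst fun n => match n with
    | 0 => 0
    | n + 1 => n + 2)) hN).congr fun v => ?_
  have : ∀ (w : ℕ → ℤ) (n : ℕ), Nat.rec (motive := fun _ => ℤ) 0 (fun t x => x + g t w) n =
      ∑ t ∈ Finset.range n, g t w := by
    intro w n
    induction n with
    | zero => simp
    | succ n ih => rw [Finset.sum_range_succ, ← ih]
  simp only [this]

theorem pow {f : (ℕ → ℤ) → ℤ} (hf : ArithFun f) (hN : ArithFun N) :
    ArithFun fun v => f v ^ (N v).toNat := by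
  refine (natRec (s := fun _ x v => x * f v) one ((var 1).mul (hf.subst fun n => n + 2))
    hN).congr fun v => ?_
  have : ∀ (w : ℕ → ℤ) (n : ℕ), Nat.rec (motive := fun _ => ℤ) 1 (fun _ x => x * f w) n =
      f w ^ n := by
    intro w n
    induction n with
    | zero => simp
    | succ n ih => rw [pow_succ, ← ih]
  simp only [this]

end ArithFun

end PseudoFinite

namespace PseudoFinite

/-! ### Transfer and genericity -/

section Transfer

variable {D : Ultrafilter Nat.Primes}

open FirstOrder FirstOrder.Language

theorem realize_term_germ {α : Type*} (t : Language.ring.Term α) (v : α → Nat.Primes → ℤ) :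
    t.realize (fun a => starZ D (v a)) = starZ D fun k => t.realize fun a => v a k := by
  induction t with
  | var => rfl
  | func f ts ih =>
    rw [Term.realize_func]
    simp only [ih, Term.realize_func]
    cases f with
    | add =>
      exact (Ring.CompatibleRing.funMap_add _).trans
        (congrArg (starZ D) (funext fun k =>
          (Ring.CompatibleRing.funMap_add fun i => (ts i).realize fun a => v a k).symm))
    | mul =>
      exact (Ring.CompatibleRing.funMap_mul _).trans
        (congrArg (starZ D) (funext fun k =>
          (Ring.CompatibleRing.funMap_mul fun i => (ts i).realize fun a => v a k).symm))
    | neg =>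
      exact (Ring.CompatibleRing.funMap_neg _).trans
        (congrArg (starZ D) (funext fun k =>
          (Ring.CompatibleRing.funMap_neg fun i => (ts i).realize fun a => v a k).symm))
    | zero =>
      exact (Ring.CompatibleRing.funMap_zero _).trans
        (congrArg (starZ D) (funext fun k =>
          (Ring.CompatibleRing.funMap_zero fun i => (ts i).realize fun a => v a k).symm))
    | one =>
      exact (Ring.CompatibleRing.funMap_one _).trans
        (congrArg (starZ D) (funext fun k =>
          (Ring.CompatibleRing.funMap_one fun i => (ts i).realize fun a => v a k).symm))

/-- Łoś's theorem for `ℤ`, by induction on the formula. The implication case needs an ultrafilter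
and the quantifier case needs choice. -/
theorem realize_boundedFormula_germ {α : Type*} {n : ℕ} (φ : Language.ring.BoundedFormula α n)
    (v : α → Nat.Primes → ℤ) (x : Fin n → Nat.Primes → ℤ) :
    φ.Realize (fun a => starZ D (v a)) (fun i => starZ D (x i)) ↔
      ∀ᶠ k in (D : Filter Nat.Primes), φ.Realize (fun a => v a k) fun i => x i k := by
  induction φ with
  | falsum => simp [BoundedFormula.Realize, D.neBot.ne]
  | equal t₁ t₂ =>
    have h : ∀ t : Language.ring.Term (α ⊕ Fin _),
        t.realize (Sum.elim (fun a => starZ D (v a)) fun i => starZ D (x i)) =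
          starZ D fun k => t.realize (Sum.elim (fun a => v a k) fun i => x i k) := by
      intro t
      have h1 : (Sum.elim (fun a => starZ D (v a)) fun i => starZ D (x i)) =
          fun s => starZ D (Sum.elim v x s) := by
        funext s; cases s <;> rfl
      rw [h1, realize_term_germ]
      refine congrArg (starZ D) (funext fun k => congrArg t.realize (funext fun s => ?_))
      cases s <;> rfl
    simp only [BoundedFormula.Realize, h]
    exact Germ.coe_eq
  | rel r => exact r.elim
  | imp φ ψ ihφ ihψ => simp only [BoundedFormula.realize_imp, ihφ, ihψ, Ultrafilter.eventually_imp]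
  | all φ ih =>
    have hs : ∀ y : Nat.Primes → ℤ, (Fin.snoc (fun i => starZ D (x i)) (starZ D y) : _ → StarZ D) =
        fun i => starZ D ((Fin.snoc x y : Fin (_ + 1) → Nat.Primes → ℤ) i) := by
      intro y; funext i
      refine Fin.lastCases ?_ (fun j => ?_) i <;> simp
    have hs' : ∀ (y : Nat.Primes → ℤ) k, (fun i => (Fin.snoc x y : Fin (_ + 1) → _) i k) =
        (Fin.snoc (fun i => x i k) (y k) : Fin (_ + 1) → ℤ) := by
      intro y k; funext i
      refine Fin.lastCases ?_ (fun j => ?_) i <;> simp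
    simp only [BoundedFormula.realize_all]
    constructor
    · intro h
      -- If the universal statement fails at almost all coordinates, the counterexamples chosen
      -- there form a single germ that contradicts `h`.
      by_contra hc
      rw [← Ultrafilter.eventually_not] at hc
      simp only [not_forall] at hc
      obtain ⟨y, hy⟩ := hc.choice
      have := h (starZ D y)
      rw [hs, ih] at this
      obtain ⟨k, hk, hk'⟩ := (this.and hy).exists
      rw [hs'] at hk
      exact hk' hk
    · intro h y
      induction y using Germ.inductionOn with | _ y => ?_
      have := hs y
      erw [this, ih]
      filter_upwards [h] with k hk
      rw [hs']
      exact hk _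

theorem realize_formula_germ {α : Type*} (φ : Language.ring.Formula α)
    (v : α → Nat.Primes → ℤ) :
    φ.Realize (fun a => starZ D (v a)) ↔
      ∀ᶠ k in (D : Filter Nat.Primes), φ.Realize fun a => v a k := by
  have := realize_boundedFormula_germ (D := D) φ v default
  simp only [Formula.Realize]
  convert this using 3 with k
  exact iff_of_eq (congrArg (BoundedFormula.Realize φ _) (funext fun i => i.elim0))

end Transfer

/-- The stream `x, y, p, e, i, i, i, …`. -/
def params (x y p e i : ℤ) : ℕ → ℤ
  | 0 => x
  | 1 => y
  | 2 => p
  | 3 => e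
  | _ => i

namespace Params

variable {D : Ultrafilter Nat.Primes} (P : Params D)

open FirstOrder FirstOrder.Language

theorem mem_funs_iff (f : StarZ D → StarZ D) :
    f ∈ P.funs ↔ (∃ φ : Language.ring.Formula (P.Ω ⊕ Fin 2),
      ∀ x y, φ.Realize (Sum.elim (↑) ![x, y]) ↔ y = f x) ∧ ∀ n : ℕ, ∃ k : ℕ, f n = k := by
  refine and_congr_left fun _ => ?_
  rw [Set.Definable₂, Set.definable_iff_exists_formula_sum]
  refine exists_congr fun φ => ⟨fun h x y => ?_, fun h => Set.ext fun x => ?_⟩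
  · have := Set.ext_iff.1 h ![x, y]
    exact this.symm
  · have := h (x 0) (x 1)
    have hx : ![x 0, x 1] = x := by ext i; fin_cases i <;> rfl
    rw [hx] at this
    exact this.symm

/-- Genericity concerns formulas in `x` alone, so the value `f x` is quantified away: it is applied
to `∃ y, R(x, y, p, ε, i) ∧ y = f x`. Because `f` maps `ℕ` to `ℕ`, the assumption is needed only for
standard pairs. -/
theorem generic_transfer (hP : P.FiniteGeneric ![starZ D P.l]) {R : (ℕ → ℤ) → Prop} (hR : Arith R)
    {f : StarZ D → StarZ D} (hf : f ∈ P.funs)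
    (h : ∀ n m : ℕ, f n = m →
      ∀ᶠ k in (D : Filter Nat.Primes), R (params n m (P.p k) (P.e k) (P.i k)))
    {y : Nat.Primes → ℤ} (hy : f (starZ D P.l) = starZ D y) :
    ∀ᶠ k in (D : Filter Nat.Primes), R (params (P.l k) (y k) (P.p k) (P.e k) (P.i k)) := by
  obtain ⟨φ, hφ⟩ := hR
  obtain ⟨⟨ψ, hψ⟩, hfn⟩ := (P.mem_funs_iff f).1 hf
  have hp : starZ D P.p ∈ P.Ω := Or.inl rfl
  have he : starZ D P.e ∈ P.Ω := Or.inr (Or.inl rfl)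
  have hi : starZ D P.i ∈ P.Ω := Or.inr (Or.inr rfl)
  -- Parameters go to constants from `Ω`, the first entry to the free variable `x`, and the second
  -- to the bound variable `y`.
  let σ : ℕ → (P.Ω ⊕ Fin 1) ⊕ Fin 1 := fun n => match n with
    | 0 => Sum.inl (Sum.inr 0)
    | 1 => Sum.inr 0
    | 2 => Sum.inl (Sum.inl ⟨_, hp⟩)
    | 3 => Sum.inl (Sum.inl ⟨_, he⟩)
    | _ => Sum.inl (Sum.inl ⟨_, hi⟩)
  let τ : P.Ω ⊕ Fin 2 → (P.Ω ⊕ Fin 1) ⊕ Fin 1 :=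
    Sum.elim (fun a => Sum.inl (Sum.inl a)) ![Sum.inl (Sum.inr 0), Sum.inr 0]
  have key : ∀ x y : Nat.Primes → ℤ,
      φ.Realize (Sum.elim (Sum.elim (↑) fun _ => starZ D x) (fun _ => starZ D y) ∘ σ) ↔
      ∀ᶠ k in (D : Filter Nat.Primes), R (params (x k) (y k) (P.p k) (P.e k) (P.i k)) := by
    intro x y
    have := realize_formula_germ (D := D) φ fun n k => params (x k) (y k) (P.p k) (P.e k) (P.i k) n
    simp only [hφ] at this
    rw [← this]
    refine iff_of_eq (congrArg φ.Realize (funext fun n => ?_))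
    match n with
    | 0 => rfl
    | 1 => rfl
    | 2 => rfl
    | 3 => rfl
    | _ + 4 => rfl
  have keyτ : ∀ x y : StarZ D,
      ψ.Realize (Sum.elim (Sum.elim (↑) fun _ => x) (fun _ => y) ∘ τ) ↔ y = f x := by
    intro x y
    rw [← hψ]
    refine iff_of_eq (congrArg ψ.Realize (funext fun n => ?_))
    rcases n with n | n
    · rfl
    · fin_cases n <;> rfl
  let χ : Language.ring.Formula (P.Ω ⊕ Fin 1) := (φ.relabel σ ⊓ ψ.relabel τ).iExs (Fin 1)
  have hχ : ∀ x, χ.Realize (Sum.elim (↑) fun _ => starZ D x) ↔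
      ∃ y : Nat.Primes → ℤ, starZ D y = f (starZ D x) ∧
      ∀ᶠ k in (D : Filter Nat.Primes), R (params (x k) (y k) (P.p k) (P.e k) (P.i k)) := by
    intro x
    rw [Formula.realize_iExs]
    simp only [Formula.realize_inf, Formula.realize_relabel]
    constructor
    · rintro ⟨y, h1, h2⟩
      obtain ⟨y', hy'⟩ : ∃ y' : Nat.Primes → ℤ, y = fun _ => starZ D y' := by
        obtain ⟨y', hy'⟩ := Quotient.exists_rep (y 0)
        exact ⟨y', funext fun i => (congrArg y (Subsingleton.elim i 0)).trans hy'.symm⟩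
      subst hy'
      exact ⟨y', (keyτ _ _).1 h2, (key _ _).1 h1⟩
    · rintro ⟨y, h1, h2⟩
      exact ⟨fun _ => starZ D y, (key _ _).2 h2, (keyτ _ _).2 h1⟩
  have hS := hP {w | χ.Realize (Sum.elim (↑) w)}
    (Set.definable_iff_exists_formula_sum.2 ⟨χ, rfl⟩) fun n => by
      obtain ⟨m, hm⟩ := hfn (n 0)
      have := (hχ fun _ => (n 0 : ℤ)).2 ⟨fun _ => (m : ℤ), hm.symm, h _ _ hm⟩
      have h2 : (fun t => (n t : StarZ D)) = fun _ => starZ D fun _ => (n 0 : ℤ) :=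
        funext fun t => by rw [Subsingleton.elim t 0]; rfl
      change χ.Realize _
      rw [h2]
      exact this
  have h2 : (![starZ D P.l] : Fin 1 → StarZ D) = fun _ => starZ D P.l :=
    funext fun t => by rw [Subsingleton.elim t 0]; rfl
  rw [h2] at hS
  obtain ⟨z, h3, h4⟩ := (hχ P.l).1 hS
  rw [hy] at h3
  filter_upwards [h4, Germ.coe_eq.1 h3] with k hk hk'
  rw [← hk']
  exact hk

/-- The common source of the closure properties of `ℱ`: the values `f x` and `g x` are carried by
two bound variables. -/
theorem funs_of_term (t : Language.ring.Term (Fin 3)) {f g : StarZ D → StarZ D} (hf : f ∈ P.funs)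
    (hg : g ∈ P.funs)
    (ht : ∀ a b c : ℕ, ∃ d : ℕ, t.realize ![(a : StarZ D), b, c] = d) :
    (fun x => t.realize ![x, f x, g x]) ∈ P.funs := by
  obtain ⟨⟨φ, hφ⟩, hfn⟩ := (P.mem_funs_iff f).1 hf
  obtain ⟨⟨ψ, hψ⟩, hgn⟩ := (P.mem_funs_iff g).1 hg
  refine (P.mem_funs_iff _).2 ⟨?_, fun n => ?_⟩
  · let σ : P.Ω ⊕ Fin 2 → (P.Ω ⊕ Fin 2) ⊕ Fin 2 :=
      Sum.elim (fun a => Sum.inl (Sum.inl a)) ![Sum.inl (Sum.inr 0), Sum.inr 0]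
    let τ : P.Ω ⊕ Fin 2 → (P.Ω ⊕ Fin 2) ⊕ Fin 2 :=
      Sum.elim (fun a => Sum.inl (Sum.inl a)) ![Sum.inl (Sum.inr 0), Sum.inr 1]
    let ρ : Fin 3 → (P.Ω ⊕ Fin 2) ⊕ Fin 2 := ![Sum.inl (Sum.inr 0), Sum.inr 0, Sum.inr 1]
    have hσ : ∀ x y (z : Fin 2 → StarZ D),
        φ.Realize (Sum.elim (Sum.elim (↑) ![x, y]) z ∘ σ) ↔ z 0 = f x := by
      intro x y z
      rw [← hφ]
      refine iff_of_eq (congrArg φ.Realize (funext fun n => ?_))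
      rcases n with n | n
      · rfl
      · fin_cases n <;> rfl
    have hτ : ∀ x y (z : Fin 2 → StarZ D),
        ψ.Realize (Sum.elim (Sum.elim (↑) ![x, y]) z ∘ τ) ↔ z 1 = g x := by
      intro x y z
      rw [← hψ]
      refine iff_of_eq (congrArg ψ.Realize (funext fun n => ?_))
      rcases n with n | n
      · rfl
      · fin_cases n <;> rfl
    have hρ : ∀ x y (z : Fin 2 → StarZ D),
        Sum.elim (Sum.elim ((↑) : P.Ω → StarZ D) ![x, y]) z ∘ ρ = ![x, z 0, z 1] := by
      intro x y z
      funext n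
      fin_cases n <;> rfl
    refine ⟨(φ.relabel σ ⊓ ψ.relabel τ ⊓
      (Term.var (Sum.inl (Sum.inr 1))).equal (t.relabel ρ)).iExs (Fin 2), fun x y => ?_⟩
    rw [Formula.realize_iExs]
    simp only [Formula.realize_inf, Formula.realize_relabel, Formula.realize_equal,
      Term.realize_relabel, hσ, hτ, hρ, Term.realize_var, Sum.elim_inl, Sum.elim_inr]
    constructor
    · rintro ⟨z, ⟨h1, h2⟩, h3⟩
      rw [← h1, ← h2]
      exact h3
    · intro h
      exact ⟨![f x, g x], ⟨rfl, rfl⟩, h⟩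
  · obtain ⟨a, ha⟩ := hfn n
    obtain ⟨b, hb⟩ := hgn n
    simp only [ha, hb]
    exact ht _ _ _

theorem one_mem_funs : (1 : StarZ D → StarZ D) ∈ P.funs := by
  refine (P.mem_funs_iff _).2 ⟨⟨(Term.var (Sum.inr 1)).equal 1, fun x y => ?_⟩,
    fun n => ⟨1, by simp⟩⟩
  simp

theorem add_mem_funs {f g : StarZ D → StarZ D} (hf : f ∈ P.funs) (hg : g ∈ P.funs) :
    f + g ∈ P.funs := by
  have := P.funs_of_term (Term.var 1 + Term.var 2) hf hg fun a b c => ⟨b + c, by simp⟩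
  simpa using! this

theorem mul_mem_funs {f g : StarZ D → StarZ D} (hf : f ∈ P.funs) (hg : g ∈ P.funs) :
    f * g ∈ P.funs := by
  have := P.funs_of_term (Term.var 1 * Term.var 2) hf hg fun a b c => ⟨b * c, by simp⟩
  simpa using! this

theorem id_mem_funs : (id : StarZ D → StarZ D) ∈ P.funs :=
  P.funs_of_term (Term.var 0) P.one_mem_funs P.one_mem_funs fun a _ _ => ⟨a, by simp⟩

theorem natCast_mem_funs (n : ℕ) : (fun _ => (n : StarZ D)) ∈ P.funs := by
  induction n with
  | zero =>
    have := P.funs_of_term 0 P.one_mem_funs P.one_mem_funs fun _ _ _ => ⟨0, by simp⟩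
    simpa using this
  | succ n ih =>
    convert P.add_mem_funs ih P.one_mem_funs using 1
    funext x
    simp

theorem pow_mem_funs {f : StarZ D → StarZ D} (hf : f ∈ P.funs) (n : ℕ) : f ^ n ∈ P.funs := by
  induction n with
  | zero => simpa using P.one_mem_funs
  | succ n ih =>
    rw [pow_succ]
    exact P.mul_mem_funs ih hf

end Params

end PseudoFinite

namespace PseudoFinite

open Polynomial

/-! ### Sizes of polynomials -/

/-- A submultiplicative seminorm with values in the natural numbers. -/
structure IsSize {R : Type*} [CommRing R] (μ : R → ℕ) : Prop where
  zero : μ 0 = 0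
  add_le : ∀ a b, μ (a + b) ≤ μ a + μ b
  mul_le : ∀ a b, μ (a * b) ≤ μ a * μ b
  neg : ∀ a, μ (-a) = μ a

/-- The sum of the sizes of the coefficients of a polynomial. -/
def coeffSize {R : Type*} [CommRing R] (μ : R → ℕ) (p : R[X]) : ℕ := p.sum fun _ a => μ a

namespace IsSize

theorem natAbs : IsSize Int.natAbs where
  zero := rfl
  add_le := Int.natAbs_add_le
  mul_le a b := (Int.natAbs_mul a b).le
  neg := Int.natAbs_neg

variable {R : Type*} [CommRing R] {μ : R → ℕ} (hμ : IsSize μ)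
include hμ

theorem sum_le {ι : Type*} (s : Finset ι) (f : ι → R) : μ (∑ i ∈ s, f i) ≤ ∑ i ∈ s, μ (f i) :=
  Finset.le_sum_of_subadditive μ hμ.zero.le hμ.add_le s f

theorem coeffSize_eq_sum_range {p : R[X]} {n : ℕ} (hn : p.natDegree < n) :
    coeffSize μ p = ∑ i ∈ Finset.range n, μ (p.coeff i) :=
  sum_over_range' p (fun _ => hμ.zero) n hn

theorem coeffSize_monomial (n : ℕ) (a : R) : coeffSize μ (monomial n a) = μ a :=
  sum_monomial_index a (fun _ b => μ b) hμ.zero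

theorem coeffSize_add_le (p q : R[X]) :
    coeffSize μ (p + q) ≤ coeffSize μ p + coeffSize μ q := by
  have h := natDegree_add_le p q
  set n := max p.natDegree q.natDegree + 1
  rw [hμ.coeffSize_eq_sum_range (n := n) (by omega), hμ.coeffSize_eq_sum_range (n := n) (by omega),
    hμ.coeffSize_eq_sum_range (n := n) (by omega), ← Finset.sum_add_distrib]
  exact Finset.sum_le_sum fun i _ => by rw [coeff_add]; exact hμ.add_le _ _

theorem coeffSize_sum_le {ι : Type*} (s : Finset ι) (f : ι → R[X]) :
    coeffSize μ (∑ i ∈ s, f i) ≤ ∑ i ∈ s, coeffSize μ (f i) :=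
  Finset.le_sum_of_subadditive _ (by simp [coeffSize]) hμ.coeffSize_add_le s f

theorem coeffSize_mul_le (p q : R[X]) :
    coeffSize μ (p * q) ≤ coeffSize μ p * coeffSize μ q := by
  rw [mul_eq_sum_sum]
  refine (hμ.coeffSize_sum_le _ _).trans ?_
  rw [coeffSize, coeffSize, Polynomial.sum, Polynomial.sum, Finset.sum_mul_sum]
  refine Finset.sum_le_sum fun i _ => ?_
  rw [Polynomial.sum]
  refine (hμ.coeffSize_sum_le _ _).trans (Finset.sum_le_sum fun j _ => ?_)
  rw [hμ.coeffSize_monomial]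
  exact hμ.mul_le _ _

/-- Since the construction returns a size, it can be iterated to give the `ℓ¹` norm on `ℤ[X][X]`. -/
theorem coeffSize : IsSize (coeffSize μ) where
  zero := by simp [PseudoFinite.coeffSize]
  add_le := hμ.coeffSize_add_le
  mul_le := hμ.coeffSize_mul_le
  neg p := by simp [PseudoFinite.coeffSize, Polynomial.sum, hμ.neg]

theorem le_coeffSize (p : R[X]) (n : ℕ) : μ (p.coeff n) ≤ PseudoFinite.coeffSize μ p := by
  rw [hμ.coeffSize_eq_sum_range (n := max p.natDegree n + 1) (by omega)]
  exact Finset.single_le_sum (f := fun i => μ (p.coeff i)) (fun _ _ => Nat.zero_le _)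
    (Finset.mem_range.2 (by omega))

end IsSize

theorem norm_aeval_le (p : ℤ[X]) {z : ℂ} (hz : ‖z‖ ≤ 1) :
    ‖aeval z p‖ ≤ coeffSize Int.natAbs p := by
  rw [aeval_eq_sum_range, IsSize.natAbs.coeffSize_eq_sum_range (Nat.lt_succ_self _), Nat.cast_sum]
  refine (norm_sum_le _ _).trans (Finset.sum_le_sum fun i _ => ?_)
  rw [zsmul_eq_mul, norm_mul, norm_pow, Complex.norm_intCast, Nat.cast_natAbs, Int.cast_abs]
  exact mul_le_of_le_one_right (abs_nonneg _) (pow_le_one₀ (norm_nonneg _) hz)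

/-! ### Polynomial values at roots of unity in characteristic zero and in large characteristic -/

/-- The cyclotomic polynomial is the minimal polynomial of `z` over `ℤ`, hence divides `p`, and it
vanishes at `g` in every characteristic. -/
theorem aeval_primitiveRoot_eq_zero {l : ℕ} (hl : 0 < l) {K : Type*} [Field K] {g : K}
    (hg : IsPrimitiveRoot g l) {z : ℂ} (hz : IsPrimitiveRoot z l) {p : ℤ[X]} (hp : aeval z p = 0) :
    aeval g p = 0 := by
  have h : cyclotomic l ℤ ∣ p := by
    rw [cyclotomic_eq_minpoly hz hl]
    exact minpoly.isIntegrallyClosed_dvd (hz.isIntegral hl) hp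
  obtain ⟨q, rfl⟩ := h
  have := hg.isRoot_cyclotomic hl
  rw [IsRoot.def, ← map_cyclotomic_int, eval_map, ← algebraMap_int_eq, ← aeval_def] at this
  rw [map_mul, this, zero_mul]

/-- Let `N` be the resultant of the cyclotomic polynomial with `p`. It is a polynomial combination
of the two, so a common root `g` forces `q ∣ N`. It is also the product of the values of `p` at the
complex primitive `l`-th roots of unity, so `0 < |N| ≤ size^l < q`. -/
theorem aeval_primitiveRoot_ne_zero {l : ℕ} (hl : 0 < l) {K : Type*} [Field K] {q : ℕ} [CharP K q]
    {g : K} (hg : IsPrimitiveRoot g l) {z : ℂ} (hz : IsPrimitiveRoot z l) {p : ℤ[X]}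
    (hq : coeffSize Int.natAbs p ^ l < q) (hp : aeval z p ≠ 0) : aeval g p ≠ 0 := by
  intro h
  have hdeg : (cyclotomic l ℤ).natDegree ≠ 0 := by
    rw [natDegree_cyclotomic]
    exact (Nat.totient_pos.2 hl).ne'
  obtain ⟨a, b, -, -, hab⟩ := exists_mul_add_mul_eq_C_resultant (cyclotomic l ℤ) p le_rfl le_rfl
    (Or.inl hdeg)
  set N : ℤ := (cyclotomic l ℤ).resultant p with hN
  have h1 : (q : ℤ) ∣ N := by
    have h2 := congrArg (aeval g) hab
    have h3 := hg.isRoot_cyclotomic hl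
    rw [IsRoot.def, ← map_cyclotomic_int, eval_map, ← algebraMap_int_eq, ← aeval_def] at h3
    rw [map_add, map_mul, map_mul, h, h3, zero_mul, zero_mul, add_zero, aeval_C, algebraMap_int_eq,
      eq_intCast] at h2
    exact (CharP.intCast_eq_zero_iff K q N).1 h2.symm
  have h2 : (N : ℂ) = ((cyclotomic l ℂ).roots.map fun w => aeval w p).prod := by
    have h3 := resultant_map_map (cyclotomic l ℤ) p (cyclotomic l ℤ).natDegree p.natDegree
      (Int.castRingHom ℂ)
    rw [map_cyclotomic_int, eq_intCast, natDegree_cyclotomic, ← natDegree_cyclotomic l ℂ,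
      resultant_eq_prod_eval _ _ _ natDegree_map_le (IsAlgClosed.splits _),
      (cyclotomic.monic l ℂ).leadingCoeff, one_pow, one_mul] at h3
    rw [hN, natDegree_cyclotomic, ← natDegree_cyclotomic l ℂ, ← h3]
    refine congrArg _ (Multiset.map_congr rfl fun w _ => ?_)
    rw [eval_map, ← algebraMap_int_eq, ← aeval_def]
  have hroot : ∀ w ∈ (cyclotomic l ℂ).roots, IsPrimitiveRoot w l := by
    intro w hw
    have : NeZero (l : ℂ) := ⟨by exact_mod_cast hl.ne'⟩
    exact isRoot_cyclotomic_iff.1 (isRoot_of_mem_roots hw)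
  have h3 : (N : ℂ) ≠ 0 := by
    rw [h2]
    -- Conjugacy: a zero of `p` at one primitive root `w` would give a zero at `z`.
    refine Multiset.prod_ne_zero fun h0 => ?_
    obtain ⟨w, hw, hw0⟩ := Multiset.mem_map.1 h0
    exact hp (aeval_primitiveRoot_eq_zero hl hz (hroot w hw) hw0)
  -- This allows the exponent, at most the totient of `l`, to be raised to `l`.
  have hp0 : 1 ≤ coeffSize Int.natAbs p := by
    by_contra hc
    refine hp (norm_le_zero_iff.1 ((norm_aeval_le p ?_).trans ?_))
    · exact (hz.norm'_eq_one hl.ne').le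
    · rw [show coeffSize Int.natAbs p = 0 by omega, Nat.cast_zero]
  have h4 : ‖(N : ℂ)‖ ≤ (coeffSize Int.natAbs p : ℝ) ^ l := by
    have h5 : ∀ s : Multiset ℂ, (∀ w ∈ s, IsPrimitiveRoot w l) →
        ‖(s.map fun w => aeval w p).prod‖ ≤ (coeffSize Int.natAbs p : ℝ) ^ s.card := by
      intro s
      induction s using Multiset.induction_on with
      | empty => simp
      | cons w s ih =>
        intro hs
        rw [Multiset.map_cons, Multiset.prod_cons, norm_mul, Multiset.card_cons, pow_succ']
        exact mul_le_mul (norm_aeval_le p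
          ((hs w (Multiset.mem_cons_self _ _)).norm'_eq_one hl.ne').le)
          (ih fun x hx => hs x (Multiset.mem_cons_of_mem hx)) (norm_nonneg _) (Nat.cast_nonneg _)
    rw [h2]
    refine (h5 _ hroot).trans (pow_le_pow_right₀ (by exact_mod_cast hp0) ?_)
    refine (card_roots' _).trans ?_
    rw [natDegree_cyclotomic]
    exact Nat.totient_le l
  have h6 : (q : ℤ) ≤ |N| :=
    Int.le_of_dvd (abs_pos.2 (by exact_mod_cast h3)) ((dvd_abs _ _).2 h1)
  rw [Complex.norm_intCast] at h4
  have h7 : |N| ≤ (coeffSize Int.natAbs p : ℤ) ^ l := by exact_mod_cast h4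
  have h8 : ((coeffSize Int.natAbs p ^ l : ℕ) : ℤ) < q := by exact_mod_cast hq
  push_cast at h8
  omega

/-! ### Linear independence of the powers of a transcendental element -/

/-- The coefficients need only be algebraic over `k`, since `x` stays transcendental over the
algebraic closure of `k` in `L`. -/
theorem coeff_eq_zero_of_transcendental {k L : Type*} [Field k] [Field L] [Algebra k L] {x : L}
    (hx : Transcendental k x) {c : ℕ → L} (hc : ∀ n, IsAlgebraic k (c n)) {N : ℕ}
    (h : ∑ n ∈ Finset.range N, c n * x ^ n = 0) : ∀ n < N, c n = 0 := by
  let A := algebraicClosure k L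
  have hx' : Transcendental A x := fun h => hx (h.restrictScalars k)
  let d : ℕ → A := fun n => ⟨c n, (mem_algebraicClosure_iff).2 (hc n)⟩
  let p : A[X] := ∑ n ∈ Finset.range N, C (d n) * X ^ n
  have hp : aeval x p = 0 := by
    rw [← h, map_sum]
    refine Finset.sum_congr rfl fun n _ => ?_
    rw [map_mul, aeval_C, map_pow, aeval_X]
    rfl
  have hp0 : p = 0 := (transcendental_iff.1 hx') p hp
  intro n hn
  have := congrArg (fun p => p.coeff n) hp0
  simp only [p, finsetSum_coeff, coeff_C_mul_X_pow, coeff_zero] at this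
  rw [Finset.sum_ite_eq, if_pos (Finset.mem_range.2 hn)] at this
  exact congrArg Subtype.val this

theorem isAlgebraic_aeval {k L : Type*} [Field k] [Field L] [Algebra k L] {x : L}
    (hx : IsAlgebraic k x) (p : ℤ[X]) : IsAlgebraic k (aeval x p) := by
  rw [← mem_algebraicClosure_iff] at hx ⊢
  rw [aeval_eq_sum_range]
  exact sum_mem fun i _ => zsmul_mem (pow_mem hx i) _

/-! ### Evaluation of polynomials in two variables -/

/-- The value of a polynomial in two variables, with `x` for the inner and `y` for the outer one. -/
noncomputable def biEval {R : Type*} [CommRing R] (x y : R) : ℤ[X][X] →+* R :=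
  eval₂RingHom (aeval x : ℤ[X] →ₐ[ℤ] R).toRingHom y

theorem biEval_eq_sum {R : Type*} [CommRing R] (x y : R) {Q : ℤ[X][X]} {n : ℕ}
    (hn : Q.natDegree < n) :
    biEval x y Q = ∑ r ∈ Finset.range n, aeval x (Q.coeff r) * y ^ r :=
  eval₂_eq_sum_range' _ hn _

theorem biEval_monomial {R : Type*} [CommRing R] (x y : R) (r s : ℕ) (a : ℤ) :
    biEval x y (monomial r (monomial s a)) = a * x ^ s * y ^ r := by
  simp [biEval, eval₂_monomial, aeval_monomial]

theorem biEval_eq_zero_iff_of_transcendental {x y : ℂ} (hx : IsAlgebraic ℚ x)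
    (hy : Transcendental ℚ y) (Q : ℤ[X][X]) :
    biEval x y Q = 0 ↔ ∀ r, aeval x (Q.coeff r) = 0 := by
  have h1 : ∀ p : ℤ[X], IsAlgebraic ℚ (aeval x p) := fun p =>
    isAlgebraic_aeval hx p
  constructor
  · intro h r
    rcases le_or_gt r Q.natDegree with hr | hr
    · rw [biEval_eq_sum x y (Nat.lt_succ_self _)] at h
      exact coeff_eq_zero_of_transcendental hy (fun n => h1 _) h r (Nat.lt_succ_of_le hr)
    · rw [coeff_eq_zero_of_natDegree_lt hr, map_zero]
  · intro h
    rw [biEval_eq_sum x y (Nat.lt_succ_self _)]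
    exact Finset.sum_eq_zero fun r _ => by rw [h, zero_mul]

end PseudoFinite

namespace PseudoFinite

open Polynomial

/-! ### Reduction modulo `p` and pointwise properties of the parameters -/

variable {D : Ultrafilter Nat.Primes}

theorem starZ_dvd_iff {x y : Nat.Primes → ℤ} :
    starZ D x ∣ starZ D y ↔ ∀ᶠ k in (D : Filter Nat.Primes), x k ∣ y k := by
  constructor
  · rintro ⟨c, hc⟩
    induction c using Germ.inductionOn with | _ c => ?_
    filter_upwards [Germ.coe_eq.1 hc] with k hk
    exact ⟨c k, hk⟩
  · intro h
    obtain ⟨c, hc⟩ := h.choice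
    exact ⟨starZ D c, Germ.coe_eq.2 hc⟩

theorem starZ_eq_iff {x y : Nat.Primes → ℤ} :
    starZ D x = starZ D y ↔ ∀ᶠ k in (D : Filter Nat.Primes), x k = y k :=
  Germ.coe_eq

theorem starZ_le_iff {x y : Nat.Primes → ℤ} :
    starZ D x ≤ starZ D y ↔ ∀ᶠ k in (D : Filter Nat.Primes), x k ≤ y k :=
  Germ.coe_le

theorem starZ_lt_iff {x y : Nat.Primes → ℤ} :
    starZ D x < starZ D y ↔ ∀ᶠ k in (D : Filter Nat.Primes), x k < y k :=
  Germ.coe_lt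

theorem starC_eq_iff {x y : Nat.Primes → ℂ} :
    starC D x = starC D y ↔ ∀ᶠ k in (D : Filter Nat.Primes), x k = y k :=
  Germ.coe_eq

namespace Params

variable (P : Params D)

/-- Reduction modulo `p` as a ring homomorphism. -/
noncomputable def redHom : (Nat.Primes → ℤ) →+* P.Fp where
  toFun := P.red
  map_one' := rfl
  map_mul' _ _ := rfl
  map_zero' := rfl
  map_add' _ _ := rfl

theorem redHom_apply (x : Nat.Primes → ℤ) : P.redHom x = P.red x := rfl

theorem redHom_surjective : Function.Surjective P.redHom := by
  intro x
  obtain ⟨z, rfl⟩ := Ideal.Quotient.mk_surjective x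
  induction z using Germ.inductionOn with | _ z => ?_
  exact ⟨z, rfl⟩

theorem red_eq_red_iff {x y : Nat.Primes → ℤ} :
    P.red x = P.red y ↔ ∀ᶠ k in (D : Filter Nat.Primes), P.p k ∣ x k - y k := by
  refine (Ideal.Quotient.eq).trans ?_
  rw [Ideal.mem_span_singleton]
  exact starZ_dvd_iff

theorem red_eq_zero_iff {x : Nat.Primes → ℤ} :
    P.red x = 0 ↔ ∀ᶠ k in (D : Filter Nat.Primes), P.p k ∣ x k := by
  refine (P.red_eq_red_iff (y := 0)).trans ?_
  simp

/-- The properties of the parameters that hold at almost all places. -/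
structure Regular (k : Nat.Primes) : Prop where
  prime : (P.p k).toNat.Prime
  e_pos : 0 < P.e k
  e_lt : P.e k < P.p k
  l_pos : 0 < P.l k
  i_pos : 0 < P.i k
  u_pos : 0 < P.u k
  u_eq : P.u k * (P.i k * P.l k) = P.p k - 1
  j_sq : P.j k ^ 2 = P.i k
  primitive : IsPrimitiveRoot (P.e k : ZMod (P.p k).toNat) (P.p k - 1).toNat
  transc : Transcendental ℚ (Real.exp (P.ϖ k))

variable {P}

/-- If `p k` failed to be prime almost everywhere, the witnesses `a k`, `b k` with `p k ∣ a k * b k`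
would form two germs violating primality of `p` in `*ℤ`. -/
theorem Admissible.eventually_prime (hP : P.Admissible) :
    ∀ᶠ k in (D : Filter Nat.Primes), (P.p k).toNat.Prime := by
  have h1 : ∀ᶠ k in (D : Filter Nat.Primes), 0 < P.e k := starZ_lt_iff.1 hP.e_pos
  have h2 : ∀ᶠ k in (D : Filter Nat.Primes), P.e k < P.p k := starZ_lt_iff.1 hP.e_lt
  have h3 : ∀ᶠ k in (D : Filter Nat.Primes), Prime (P.p k) := by
    by_contra hc
    rw [← Ultrafilter.eventually_not] at hc
    have h4 : ∀ᶠ k in (D : Filter Nat.Primes), ∃ ab : ℤ × ℤ,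
        P.p k ∣ ab.1 * ab.2 ∧ ¬P.p k ∣ ab.1 ∧ ¬P.p k ∣ ab.2 := by
      filter_upwards [h1, h2, hc] with k hk1 hk2 hk3
      by_contra hc'
      push Not at hc'
      refine hk3 ⟨by omega, fun h => ?_, fun a b hab => ?_⟩
      · rcases Int.isUnit_iff.1 h with h | h <;> omega
      · by_cases ha : P.p k ∣ a
        · exact Or.inl ha
        · exact Or.inr (hc' (a, b) hab ha)
    obtain ⟨ab, hab⟩ := h4.choice
    have h5 : starZ D P.p ∣ starZ D (fun k => (ab k).1) * starZ D fun k => (ab k).2 :=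
      starZ_dvd_iff.2 (hab.mono fun k hk => hk.1)
    rcases P.prime.dvd_or_dvd h5 with h | h
    · obtain ⟨k, hk, hk'⟩ := ((starZ_dvd_iff.1 h).and hab).exists
      exact hk'.2.1 hk
    · obtain ⟨k, hk, hk'⟩ := ((starZ_dvd_iff.1 h).and hab).exists
      exact hk'.2.2 hk
  filter_upwards [h1, h2, h3] with k hk1 hk2 hk3
  rw [Nat.prime_iff_prime_int, Int.toNat_of_nonneg (by omega)]
  exact hk3

theorem intCast_zmod_eq_zero_iff {p x : ℤ} (hp : p.toNat.Prime) :
    (x : ZMod p.toNat) = 0 ↔ p ∣ x := by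
  rw [ZMod.intCast_zmod_eq_zero_iff_dvd, Int.toNat_of_nonneg]
  by_contra h
  rw [Int.toNat_of_nonpos (by omega)] at hp
  exact Nat.not_prime_zero hp

theorem Admissible.eventually_regular (hP : P.Admissible) :
    ∀ᶠ k in (D : Filter Nat.Primes), P.Regular k := by
  have h1 : ∀ᶠ k in (D : Filter Nat.Primes), 0 < P.e k := starZ_lt_iff.1 hP.e_pos
  have h2 : ∀ᶠ k in (D : Filter Nat.Primes), P.e k < P.p k := starZ_lt_iff.1 hP.e_lt
  have h3 : ∀ᶠ k in (D : Filter Nat.Primes), P.m k ^ 2 = P.l k := starZ_eq_iff.1 hP.m_sq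
  have h4 : ∀ᶠ k in (D : Filter Nat.Primes), P.j k ^ 2 = P.i k := starZ_eq_iff.1 hP.j_sq
  have h5 : ∀ᶠ k in (D : Filter Nat.Primes), P.u k * (P.i k * P.l k) = P.p k - 1 :=
    starZ_eq_iff.1 hP.u_eq
  have h6 : ∀ᶠ k in (D : Filter Nat.Primes),
      IsPrimitiveRoot (P.e k : ZMod (P.p k).toNat) (P.p k - 1).toNat := by
    -- The test exponent is the order of `e k` modulo `p k`: the hypothesis makes it a multiple of
    -- `p - 1`, and Fermat's little theorem gives the reverse divisibility.
    have h7 := (hP.exp_eq_one fun k => orderOf (P.e k : ZMod (P.p k).toNat)).1 ?_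
    · filter_upwards [h1, h2, hP.eventually_prime, starZ_dvd_iff.1 h7] with k hk1 hk2 hk3 hk4
      have := Fact.mk hk3
      have h8 : (P.e k : ZMod (P.p k).toNat) ≠ 0 := fun h0 => by
        have := Int.le_of_dvd hk1 ((intCast_zmod_eq_zero_iff hk3).1 h0)
        omega
      have h9 := orderOf_dvd_of_pow_eq_one (ZMod.pow_card_sub_one_eq_one h8)
      have h10 : (P.p k - 1).toNat = (P.p k).toNat - 1 := by omega
      rw [h10]
      have h11 : (P.p k).toNat - 1 ∣ orderOf (P.e k : ZMod (P.p k).toNat) := by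
        rw [← Int.natCast_dvd_natCast, ← h10, Int.toNat_of_nonneg (by omega)]
        exact hk4
      rw [Nat.dvd_antisymm h11 h9]
      exact IsPrimitiveRoot.orderOf _
    · refine (P.red_eq_red_iff (y := fun _ => 1)).2 ?_
      filter_upwards [hP.eventually_prime] with k hk
      rw [← intCast_zmod_eq_zero_iff hk]
      push_cast
      rw [pow_orderOf_eq_one, sub_self]
  filter_upwards [h1, h2, h3, h4, h5, h6, hP.eventually_prime, hP.transc] with
    k h1 h2 h3 h4 h5 h6 h7 h8
  have hl : 0 ≤ P.l k := h3 ▸ sq_nonneg _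
  have hi : 0 ≤ P.i k := h4 ▸ sq_nonneg _
  have hp : 1 < P.p k := by omega
  have hl' : 0 < P.l k := hl.lt_of_ne fun h => by rw [← h] at h5; simp at h5; omega
  have hi' : 0 < P.i k := hi.lt_of_ne fun h => by rw [← h] at h5; simp at h5; omega
  refine ⟨h7, h1, h2, hl', hi', ?_, h5, h4, h6, h8⟩
  by_contra hc
  have := mul_nonpos_of_nonpos_of_nonneg (not_lt.1 hc) (mul_pos hi' hl').le
  omega

theorem Admissible.dvd_l (hP : P.Admissible) {n : ℕ} (hn : 0 < n) :
    ∀ᶠ k in (D : Filter Nat.Primes), (n : ℤ) ∣ P.l k := by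
  have h1 : ∀ᶠ k in (D : Filter Nat.Primes), P.m k ^ 2 = P.l k := starZ_eq_iff.1 hP.m_sq
  have h2 : ∀ᶠ k in (D : Filter Nat.Primes), (n : ℤ) ∣ P.m k :=
    starZ_dvd_iff (x := fun _ => (n : ℤ)).1 (hP.dvd_m n hn)
  filter_upwards [h1, h2] with k hk1 hk2
  rw [← hk1, sq]
  exact hk2.mul_right _

/-- A positive number divisible by every positive standard integer is infinite. -/
theorem Admissible.le_l (hP : P.Admissible) (n : ℕ) :
    ∀ᶠ k in (D : Filter Nat.Primes), (n : ℤ) ≤ P.l k := by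
  filter_upwards [hP.eventually_regular, hP.dvd_l (Nat.succ_pos n)] with k hk1 hk2
  have := Int.le_of_dvd hk1.l_pos hk2
  push_cast at this
  omega

namespace Regular

variable {k : Nat.Primes} (hk : P.Regular k)
include hk

theorem two_le : 2 ≤ P.p k := by
  have := hk.e_pos
  have := hk.e_lt
  omega

theorem l_lt : P.l k < P.p k := by
  have h := hk.u_eq
  have h1 : 1 * P.l k ≤ P.u k * P.i k * P.l k :=
    mul_le_mul_of_nonneg_right (mul_pos hk.u_pos hk.i_pos) hk.l_pos.le
  rw [mul_assoc] at h1
  omega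

theorem v_pos : 0 < P.v k := mul_pos hk.i_pos hk.u_pos

theorem v_mul : P.v k * P.l k = P.p k - 1 := by
  rw [← hk.u_eq, v]
  ring

theorem pow_eq_pow {a b : ℕ} (h : P.p k - 1 ∣ (a : ℤ) - b) :
    (P.e k : ZMod (P.p k).toNat) ^ a = (P.e k : ZMod (P.p k).toNat) ^ b := by
  refine pow_eq_pow_of_modEq ?_ hk.primitive.pow_eq_one
  refine (Int.natCast_modEq_iff).1 ((Int.modEq_iff_dvd).2 ?_)
  have := hk.two_le
  rw [Int.toNat_of_nonneg (by omega), ← dvd_neg, neg_sub]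
  exact h

theorem expCoord_eq_pow {η : Nat.Primes → ℤ} {a : ℕ} (h : P.p k - 1 ∣ η k - a) :
    (P.expCoord η k : ZMod (P.p k).toNat) = (P.e k : ZMod (P.p k).toNat) ^ a := by
  rw [expCoord, Int.cast_pow]
  have := hk.two_le
  refine hk.pow_eq_pow ?_
  rw [Int.toNat_of_nonneg (Int.emod_nonneg _ (by omega))]
  have := (Int.dvd_self_sub_emod (x := η k) (m := P.p k - 1))
  have := dvd_sub h this
  rwa [sub_sub_sub_cancel_left] at this

theorem isPrimitiveRoot_pow_v :
    IsPrimitiveRoot ((P.e k ^ (P.v k).toNat : ℤ) : ZMod (P.p k).toNat) (P.l k).toNat := by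
  rw [Int.cast_pow]
  have := hk.two_le
  refine hk.primitive.pow (by omega) ?_
  rw [← Int.natCast_inj]
  push_cast
  rw [Int.toNat_of_nonneg (by omega), Int.toNat_of_nonneg hk.v_pos.le,
    Int.toNat_of_nonneg hk.l_pos.le, hk.v_mul]

end Regular

theorem Admissible.charZero (hP : P.Admissible) : CharZero P.Fp := by
  refine charZero_of_inj_zero fun n hn => ?_
  by_contra hn0
  have h : P.red (fun _ => (n : ℤ)) = 0 := by
    rw [← hn, ← redHom_apply]
    exact map_natCast P.redHom n
  obtain ⟨k, hk1, hk2, hk3⟩ := ((P.red_eq_zero_iff.1 h).and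
    (hP.eventually_regular.and (hP.le_l n))).exists
  have := Int.le_of_dvd (by omega) hk1
  have := hk2.l_lt
  omega

end Params

end PseudoFinite

namespace PseudoFinite

open Polynomial

/-! ### Genericity of the parameters -/

/-- A three-dimensional array is flattened in mixed radix, so that one code `c, d, w` quantifies
over all coefficients at once. -/
theorem exists_entry_eq_triple (h : ℕ → ℕ → ℕ → ℤ) (T B : ℕ) :
    ∃ c d w, ∀ t < T, ∀ r < B, ∀ s < B, entry c d w (((t : ℤ) * B + r) * B + s) = h t r s := by
  obtain ⟨c, d, w, hc⟩ := exists_entry_eq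
    (fun n => h (n / B / B) (n / B % B) (n % B)) (T * B * B)
  refine ⟨c, d, w, fun t ht r hr s hs => ?_⟩
  have hB : 0 < B := by omega
  have h1 : (t * B + r) * B + s < T * B * B := by
    calc (t * B + r) * B + s < (t * B + r) * B + B := by omega
      _ = (t * B + r + 1) * B := by ring
      _ ≤ ((t + 1) * B) * B := Nat.mul_le_mul_right _ (by rw [add_mul]; omega)
      _ ≤ T * B * B := Nat.mul_le_mul_right _ (Nat.mul_le_mul_right _ ht)
  have h2 := hc _ h1
  have h3 : ((t * B + r) * B + s) / B = t * B + r := by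
    rw [mul_comm, Nat.mul_add_div hB, Nat.div_eq_of_lt hs, add_zero]
  have h4 : ((t * B + r) * B + s) % B = s := by
    rw [mul_comm, Nat.mul_add_mod, Nat.mod_eq_of_lt hs]
  have h5 : (t * B + r) / B = t := by
    rw [mul_comm, Nat.mul_add_div hB, Nat.div_eq_of_lt hr, add_zero]
  have h6 : (t * B + r) % B = r := by
    rw [mul_comm, Nat.mul_add_mod, Nat.mod_eq_of_lt hr]
  rw [h3, h4, h5, h6] at h2
  exact_mod_cast h2

/-- For every array of integers bounded by `v 1`, with `T` times `N * v 0 + 1` times `N * v 0 + 1`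
entries: if the polynomial with these coefficients vanishes modulo `v 2` at `v 4`, `v 3 ^ u` and
`v 3 ^ (v 4 * u)`, where `u * (v 4 * v 0) = v 2 - 1`, then so do the polynomials in the last
argument alone that occur in it. -/
def NoRelation (T N : ℕ) (v : ℕ → ℤ) : Prop :=
  ∀ u : ℤ, u * (v 4 * v 0) = v 2 - 1 → ∀ c d w : ℤ,
    (∀ t r s : ℤ, (0 ≤ t ∧ t < T) ∧ (0 ≤ r ∧ r < N * v 0 + 1) ∧ (0 ≤ s ∧ s < N * v 0 + 1) →
      -v 1 ≤ entry c d w ((t * (N * v 0 + 1) + r) * (N * v 0 + 1) + s) ∧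
      entry c d w ((t * (N * v 0 + 1) + r) * (N * v 0 + 1) + s) ≤ v 1) →
    v 2 ∣ ∑ r ∈ Finset.range (N * v 0 + 1).toNat, (∑ t ∈ Finset.range (T : ℤ).toNat,
      (∑ s ∈ Finset.range (N * v 0 + 1).toNat,
        entry c d w (((t : ℤ) * (N * v 0 + 1) + r) * (N * v 0 + 1) + s) *
          (v 3 ^ (v 4 * u).toNat) ^ (s : ℤ).toNat) * v 4 ^ (t : ℤ).toNat) *
        (v 3 ^ u.toNat) ^ (r : ℤ).toNat →
    ∀ t r : ℤ, (0 ≤ t ∧ t < T) ∧ (0 ≤ r ∧ r < N * v 0 + 1) →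
      v 2 ∣ ∑ s ∈ Finset.range (N * v 0 + 1).toNat,
        entry c d w ((t * (N * v 0 + 1) + r) * (N * v 0 + 1) + s) *
          (v 3 ^ (v 4 * u).toNat) ^ (s : ℤ).toNat

open ArithFun in
theorem arith_noRelation (T N : ℕ) : Arith (NoRelation T N) := by
  have hB : ∀ n : ℕ, ArithFun fun v => N * v n + 1 := fun n =>
    ((natCast N).mul (var n)).add one
  have hE : ∀ c d w t n r s : ℕ, ArithFun fun v =>
      PseudoFinite.entry (v c) (v d) (v w) ((v t * (N * v n + 1) + v r) * (N * v n + 1) + v s) :=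
    fun c d w t n r s => ArithFun.entry (var c) (var d) (var w)
      (((((var t).mul (hB n)).add (var r)).mul (hB n)).add (var s))
  -- Once `u, c, d, w` are bound, entries 0 to 3 are `w, d, c, u` and the original stream starts at
  -- entry 4; each further bound variable shifts by one more.
  refine .forall' <| .imp (.eq ((var 0).mul ((var 5).mul (var 1))) ((var 3).sub one)) <|
    .forall' <| .forall' <| .forall' <| .imp ?_ (.imp ?_ ?_)
  · refine .forall' <| .forall' <| .forall' <| .imp (.and (.and (.le zero (var 2))
      (.lt (var 2) (natCast T))) (.and (.and (.le zero (var 1)) (.lt (var 1) (hB 7)))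
      (.and (.le zero (var 0)) (.lt (var 0) (hB 7))))) (.and (.le (var 8).neg ?_) (.le ?_ (var 8)))
    · exact hE 5 4 3 2 7 1 0
    · exact hE 5 4 3 2 7 1 0
  · refine .dvd (var 6) ?_
    refine ArithFun.sum (g := fun r v => (∑ t ∈ Finset.range (T : ℤ).toNat,
      (∑ s ∈ Finset.range (N * v 4 + 1).toNat,
        PseudoFinite.entry (v 2) (v 1) (v 0)
          (((t : ℤ) * (N * v 4 + 1) + r) * (N * v 4 + 1) + s) *
          (v 7 ^ (v 8 * v 3).toNat) ^ (s : ℤ).toNat) * v 8 ^ (t : ℤ).toNat) *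
        (v 7 ^ (v 3).toNat) ^ r.toNat) (.mul ?_ (.pow (.pow (var 8) (var 4)) (var 0))) (hB 4)
    refine ArithFun.sum (g := fun t v => (∑ s ∈ Finset.range (N * v 5 + 1).toNat,
        PseudoFinite.entry (v 3) (v 2) (v 1)
          ((t * (N * v 5 + 1) + v 0) * (N * v 5 + 1) + s) *
          (v 8 ^ (v 9 * v 4).toNat) ^ (s : ℤ).toNat) * v 9 ^ t.toNat)
      (.mul ?_ (.pow (var 10) (var 0))) (natCast T)
    refine ArithFun.sum (g := fun s v => PseudoFinite.entry (v 4) (v 3) (v 2)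
          ((v 0 * (N * v 6 + 1) + v 1) * (N * v 6 + 1) + s) *
          (v 9 ^ (v 10 * v 5).toNat) ^ s.toNat)
      (.mul ?_ (.pow (.pow (var 10) ((var 11).mul (var 6))) (var 0))) (hB 6)
    exact hE 5 4 3 1 7 2 0
  · refine .forall' <| .forall' <| .imp (.and (.and (.le zero (var 1))
      (.lt (var 1) (natCast T))) (.and (.le zero (var 0)) (.lt (var 0) (hB 6)))) <|
      .dvd (var 8) ?_
    refine ArithFun.sum (g := fun s v => PseudoFinite.entry (v 4) (v 3) (v 2)
          ((v 1 * (N * v 6 + 1) + v 0) * (N * v 6 + 1) + s) *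
          (v 9 ^ (v 10 * v 5).toNat) ^ s.toNat)
      (.mul ?_ (.pow (.pow (var 10) ((var 11).mul (var 6))) (var 0))) (hB 6)
    exact hE 5 4 3 2 7 1 0

namespace Params

variable {D : Ultrafilter Nat.Primes} {P : Params D}

theorem Admissible.transcendental_of_pow_eq (hP : P.Admissible) {n : ℕ} {x : P.Fp}
    (hx : x ^ n = P.expP fun k => P.l k * P.u k) :
    Transcendental (Subfield.closure {P.red P.i}) x := by
  intro h
  have h1 := h.pow n
  rw [hx] at h1
  exact hP.alpha h1

/-- The case of standard sizes in `NoRelation`. -/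
theorem Admissible.eq_zero_of_sum_eq_zero (hP : P.Admissible) {T : ℕ}
    (hT : T = 1 ∨ Transcendental ℤ (P.red P.i)) {n : ℕ} {x g : P.Fp}
    (hx : x ^ n = P.expP fun k => P.l k * P.u k) {m : ℕ} (hm : 0 < m) (hg : g ^ m = 1) {B : ℕ}
    {h : ℕ → ℕ → ℕ → ℤ}
    (h0 : ∑ r ∈ Finset.range B, (∑ t ∈ Finset.range T,
      (∑ s ∈ Finset.range B, (h t r s : P.Fp) * g ^ s) * P.red P.i ^ t) * x ^ r = 0) :
    ∀ t < T, ∀ r < B, ∑ s ∈ Finset.range B, (h t r s : P.Fp) * g ^ s = 0 := by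
  have := hP.charZero
  have alg : ∀ {k : Type} [Field k] [Algebra k P.Fp], IsAlgebraic k g := by
    intro k _ _
    refine (IsIntegral.of_pow hm ?_).isAlgebraic
    rw [hg]
    exact isIntegral_one
  -- `g` is a root of unity, so the innermost sums are algebraic over every base field that occurs
  -- below.
  have alg1 : ∀ {k : Type} [Field k] [Algebra k P.Fp] (t r : ℕ),
      IsAlgebraic k (∑ s ∈ Finset.range B, (h t r s : P.Fp) * g ^ s) := by
    intro k _ _ t r
    rw [← mem_algebraicClosure_iff]
    exact sum_mem fun s _ => mul_mem (intCast_mem _ _)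
      (pow_mem (mem_algebraicClosure_iff.2 alg) _)
  intro t ht r hr
  -- Powers of `x` are separated over the field generated by `i`; when `T ≠ 1`, powers of `i` are
  -- then separated over `ℚ`.
  have h1 := coeff_eq_zero_of_transcendental (hP.transcendental_of_pow_eq hx) (fun r => by
    rw [← mem_algebraicClosure_iff]
    exact sum_mem fun t _ => mul_mem (mem_algebraicClosure_iff.2 (alg1 t r)) (pow_mem
      ((algebraicClosure (Subfield.closure {P.red P.i}) P.Fp).algebraMap_mem
        ⟨P.red P.i, Subfield.subset_closure rfl⟩) _)) h0 r hr
  rcases hT with rfl | hT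
  · obtain rfl : t = 0 := by omega
    simpa using h1
  · have : IsScalarTower ℤ ℚ P.Fp := 
        IsScalarTower.of_algebraMap_eq' (RingHom.ext_int _ _)
    have hT' : Transcendental ℚ (P.red P.i) := fun h =>
      hT ((IsFractionRing.isAlgebraic_iff ℤ ℚ P.Fp).2 h)
    exact coeff_eq_zero_of_transcendental hT' (fun t => alg1 t r) h1 t ht

end Params

end PseudoFinite

/-! ### Relations between `i`, `exp_p(u)` and `exp_p(v)`: from standard to nonstandard size -/

namespace PseudoFinite

open Polynomial

namespace Params

variable {D : Ultrafilter Nat.Primes} {P : Params D}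

theorem red_intCast (n : ℤ) : P.red (n : Nat.Primes → ℤ) = (n : P.Fp) :=
  map_intCast P.redHom n

/-- There are finitely many arrays of the given standard shape and bound. A failure at almost all
coordinates is therefore due to one fixed array, which yields in `F_p` a relation with standard
integer coefficients between `i`, an `n`-th root of `α` and an `n`-th root of unity. -/
theorem Admissible.noRelation_standard (hP : P.Admissible) {T : ℕ}
    (hT : T = 1 ∨ Transcendental ℤ (P.red P.i)) (N n m : ℕ) :
    ∀ᶠ k in (D : Filter Nat.Primes), NoRelation T N (params n m (P.p k) (P.e k) (P.i k)) := by
  -- For `n = 0` the equation for `u` reads `0 = p - 1`, which is impossible.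
  rcases Nat.eq_zero_or_pos n with rfl | hn
  · filter_upwards [hP.eventually_regular] with k hk
    intro u hu
    have := hk.two_le
    simp only [params, Nat.cast_zero, mul_zero] at hu
    omega
  by_contra hc
  rw [← Ultrafilter.eventually_not] at hc
  set B : ℕ := N * n + 1 with hB
  have hB' : ((N : ℤ) * n + 1).toNat = B := by omega
  -- Arrays are taken in a finite type, so that the ultrafilter can select one; `ext` continues them
  -- by zero.
  let ext : (Fin T → Fin B → Fin B → Set.Icc (-(m : ℤ)) m) → ℕ → ℕ → ℕ → ℤ := fun H t r s =>
    if h : t < T ∧ r < B ∧ s < B then H ⟨t, h.1⟩ ⟨r, h.2.1⟩ ⟨s, h.2.2⟩ else 0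
  have h1 : ∀ᶠ k in (D : Filter Nat.Primes),
      ∃ H : (Fin T → Fin B → Fin B → Set.Icc (-(m : ℤ)) m) × Fin T × Fin B,
      ∃ u : ℤ, u * (P.i k * n) = P.p k - 1 ∧
      (P.p k ∣ ∑ r ∈ Finset.range B, (∑ t ∈ Finset.range T, (∑ s ∈ Finset.range B,
        ext H.1 t r s * (P.e k ^ (P.i k * u).toNat) ^ s) * P.i k ^ t) *
          (P.e k ^ u.toNat) ^ r) ∧
      ¬P.p k ∣ ∑ s ∈ Finset.range B,
        ext H.1 H.2.1 H.2.2 s * (P.e k ^ (P.i k * u).toNat) ^ s := by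
    filter_upwards [hc] with k hk
    simp only [NoRelation, params, hB', Int.toNat_natCast] at hk
    push Not at hk
    obtain ⟨u, hu, c, d, w, hb, hdvd, t, r, ⟨⟨ht0, htT⟩, hr0, hrB⟩, hnd⟩ := hk
    lift t to ℕ using ht0
    lift r to ℕ using hr0
    have hext : ∀ t < T, ∀ r < B, ∀ s < B,
        ext (fun t r s => ⟨_, hb t r s ⟨⟨by omega, by omega⟩, ⟨by omega, by omega⟩,
          by omega, by omega⟩⟩) t r s =
          entry c d w (((t : ℤ) * (N * n + 1) + r) * (N * n + 1) + s) := by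
      intro t ht r hr s hs
      simp only [ext, dif_pos (show t < T ∧ r < B ∧ s < B from ⟨ht, hr, hs⟩)]
    refine ⟨⟨fun t r s => ⟨_, hb t r s ⟨⟨by omega, by omega⟩, ⟨by omega, by omega⟩,
      by omega, by omega⟩⟩, ⟨t, by omega⟩, ⟨r, by omega⟩⟩, u, hu, ?_, ?_⟩
    · convert hdvd using 1
      refine Finset.sum_congr rfl fun r hr => congrArg (· * _) (Finset.sum_congr rfl fun t ht =>
        congrArg (· * _) (Finset.sum_congr rfl fun s hs => congrArg (· * _) ?_))
      exact hext t (Finset.mem_range.1 ht) r (Finset.mem_range.1 hr) s (Finset.mem_range.1 hs)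
    · convert hnd using 2
      refine Finset.sum_congr rfl fun s hs => congrArg (· * _) ?_
      exact hext t (by omega) r (by omega) s (Finset.mem_range.1 hs)
  obtain ⟨⟨H, t, r⟩, hH⟩ := Ultrafilter.eventually_exists_iff.1 h1
  obtain ⟨u, hu⟩ := hH.choice
  let x : Nat.Primes → ℤ := fun k => P.e k ^ (u k).toNat
  let g : Nat.Primes → ℤ := fun k => P.e k ^ (P.i k * u k).toNat
  have hx : P.red x ^ n = P.expP fun k => P.l k * P.u k := by
    rw [← redHom_apply, ← map_pow, redHom_apply]
    refine P.red_eq_red_iff.2 ?_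
    filter_upwards [hu, hP.eventually_regular] with k hk hk'
    rw [← intCast_zmod_eq_zero_iff hk'.prime, Int.cast_sub, hk'.expCoord_eq_pow
      (a := (u k).toNat * n), sub_eq_zero]
    · simp [x, pow_mul]
    · have h2 := hk'.u_eq
      have hu0 : 0 ≤ u k := by
        by_contra hneg
        have h3 := hk.1
        have := mul_pos hk'.i_pos (Nat.cast_pos (α := ℤ).2 hn)
        have := mul_neg_of_neg_of_pos (not_le.1 hneg) this
        have := hk'.two_le
        omega
      rw [Nat.cast_mul, Int.toNat_of_nonneg hu0]
      -- Both `u k * (i n)` and `P.u k * (i l)` equal `p - 1`; cancelling `i` shows that the `n`-th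
      -- power of `ε^u` is `α`.
      have h4 : P.i k * (P.l k * P.u k - u k * n) = 0 := by linear_combination h2 - hk.1
      rw [(mul_eq_zero.1 h4).resolve_left hk'.i_pos.ne']
      exact dvd_zero _
  have hg : P.red g ^ n = 1 := by
    rw [← redHom_apply, ← map_pow, redHom_apply]
    refine (P.red_eq_red_iff (y := fun _ => 1)).2 ?_
    filter_upwards [hu, hP.eventually_regular] with k hk hk'
    rw [← intCast_zmod_eq_zero_iff hk'.prime, Int.cast_sub, sub_eq_zero]
    have h3 : (P.i k * u k).toNat * n = (P.p k - 1).toNat := by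
      have h4 : P.i k * u k * n = P.p k - 1 := by rw [← hk.1]; ring
      have h5 : 0 ≤ P.i k * u k := by
        by_contra hneg
        have := mul_neg_of_neg_of_pos (not_le.1 hneg) (Nat.cast_pos (α := ℤ).2 hn)
        have := hk'.two_le
        omega
      rw [← h4, ← Int.natCast_inj, Nat.cast_mul, Int.toNat_of_nonneg h5,
        Int.toNat_of_nonneg (mul_nonneg h5 (Nat.cast_nonneg n))]
    have := hk'.primitive.pow_eq_one
    rw [← h3, pow_mul] at this
    simpa [g] using this
  have h2 := hP.eq_zero_of_sum_eq_zero hT hx hn hg (h := ext H) (B := B) (by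
    have h3 : P.redHom (∑ r ∈ Finset.range B, (∑ t ∈ Finset.range T,
        (∑ s ∈ Finset.range B, (ext H t r s : Nat.Primes → ℤ) * g ^ s) * P.i ^ t) * x ^ r) = 0 := by
      refine P.red_eq_zero_iff.2 ?_
      filter_upwards [hu] with k hk
      simpa [Finset.sum_apply] using hk.2.1
    simpa only [map_sum, map_mul, map_pow, redHom_apply, red_intCast] using h3) t t.2 r r.2
  have h3 : P.redHom (∑ s ∈ Finset.range B, (ext H t r s : Nat.Primes → ℤ) * g ^ s) = 0 := by
    simpa only [map_sum, map_mul, map_pow, redHom_apply, red_intCast] using h2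
  obtain ⟨k, hk, hk'⟩ := ((P.red_eq_zero_iff.1 h3).and hu).exists
  refine hk'.2.2 ?_
  simpa [Finset.sum_apply] using hk

variable (P)

/-- The sum of the absolute values of the coefficients of a polynomial in two variables. -/
noncomputable def size (Q : ℤ[X][X]) : ℕ := coeffSize (coeffSize Int.natAbs) Q

/-- `Q` has degrees at most `N * l` and size at most `f l`. -/
def Bounded (N : ℕ) (f : StarZ D → StarZ D) (Q : Nat.Primes → ℤ[X][X]) : Prop :=
  (starZ D fun k => (size (Q k) : ℤ)) ≤ f (starZ D P.l) ∧
  ∀ᶠ k in (D : Filter Nat.Primes), ((Q k).natDegree : ℤ) ≤ N * P.l k ∧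
    ∀ r, (((Q k).coeff r).natDegree : ℤ) ≤ N * P.l k

variable {P}

theorem isSize_size : IsSize size := IsSize.natAbs.coeffSize.coeffSize

theorem natAbs_coeff_le_size (Q : ℤ[X][X]) (r s : ℕ) : ((Q.coeff r).coeff s).natAbs ≤ size Q :=
  (IsSize.natAbs.le_coeffSize _ s).trans (IsSize.natAbs.coeffSize.le_coeffSize _ r)

theorem coeffSize_coeff_le_size (Q : ℤ[X][X]) (r : ℕ) :
    coeffSize Int.natAbs (Q.coeff r) ≤ size Q :=
  IsSize.natAbs.coeffSize.le_coeffSize _ r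

theorem Bounded.nonneg {N : ℕ} {f : StarZ D → StarZ D} {Q : Nat.Primes → ℤ[X][X]}
    (h : P.Bounded N f Q) : 0 ≤ f (starZ D P.l) := by
  refine le_trans ?_ h.1
  exact starZ_le_iff.2 (Eventually.of_forall fun k => Int.natCast_nonneg _)

variable (P)

/-- Sequences of polynomials in two variables with degrees in `O(l)` and coefficients in `O(ℱ)`. -/
def IsBounded (Q : Nat.Primes → ℤ[X][X]) : Prop :=
  ∃ (N : ℕ) (f : StarZ D → StarZ D), f ∈ P.funs ∧ P.Bounded N f Q

/-- The value in `F_p` of a sequence of polynomials at `exp_p(v)` and `exp_p(u)`. -/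
noncomputable def evalF : (Nat.Primes → ℤ[X][X]) →+* P.Fp :=
  P.redHom.comp (RingHom.pi fun k =>
    (biEval (P.e k ^ (P.v k).toNat) (P.e k ^ (P.u k).toNat)).comp (Pi.evalRingHom _ k))

theorem evalF_apply (Q : Nat.Primes → ℤ[X][X]) :
    P.evalF Q = P.red fun k => biEval (P.e k ^ (P.v k).toNat) (P.e k ^ (P.u k).toNat) (Q k) := rfl

variable {P}

theorem Bounded.mono {N N' : ℕ} {f f' : StarZ D → StarZ D} {Q : Nat.Primes → ℤ[X][X]}
    (hP : P.Admissible) (h : P.Bounded N f Q) (hN : N ≤ N')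
    (hf : f (starZ D P.l) ≤ f' (starZ D P.l)) : P.Bounded N' f' Q := by
  refine ⟨h.1.trans hf, ?_⟩
  filter_upwards [h.2, hP.eventually_regular] with k hk hk'
  have := mul_le_mul_of_nonneg_right (Nat.cast_le (α := ℤ).2 hN) hk'.l_pos.le
  exact ⟨hk.1.trans this, fun r => (hk.2 r).trans this⟩

theorem IsBounded.exists_common (hP : P.Admissible) {Q : ℕ → Nat.Primes → ℤ[X][X]} (T : ℕ)
    (hQ : ∀ t < T, P.IsBounded (Q t)) :
    ∃ (N : ℕ) (f : StarZ D → StarZ D), f ∈ P.funs ∧ 0 ≤ f (starZ D P.l) ∧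
      ∀ t < T, P.Bounded N f (Q t) := by
  induction T with
  | zero => exact ⟨0, 1, P.one_mem_funs, zero_le_one, fun t ht => absurd ht (Nat.not_lt_zero t)⟩
  | succ T ih =>
    obtain ⟨N, f, hf, hf0, h⟩ := ih fun t ht => hQ t (by omega)
    obtain ⟨N', f', hf', h'⟩ := hQ T (by omega)
    refine ⟨N + N', f + f', P.add_mem_funs hf hf', add_nonneg hf0 h'.nonneg, fun t ht => ?_⟩
    rcases Nat.lt_succ_iff_lt_or_eq.1 ht with ht | rfl
    · exact (h t ht).mono hP (by omega) (le_add_of_nonneg_right h'.nonneg)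
    · exact h'.mono hP (by omega) (le_add_of_nonneg_left hf0)

/-- A polynomial relation between `i`, `exp_p(u)` and `exp_p(v)` is trivial in `i` and `exp_p(u)`. -/
theorem Admissible.dvd_of_sum_evalF_eq_zero (hP : P.Admissible) {T : ℕ}
    (hT : T = 1 ∨ Transcendental ℤ (P.red P.i)) {Q : ℕ → Nat.Primes → ℤ[X][X]}
    (hQ : ∀ t < T, P.IsBounded (Q t))
    (h0 : ∑ t ∈ Finset.range T, P.evalF (Q t) * P.red P.i ^ t = 0) :
    ∀ t < T, ∀ᶠ k in (D : Filter Nat.Primes),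
      ∀ r, P.p k ∣ aeval (P.e k ^ (P.v k).toNat) ((Q t k).coeff r) := by
  obtain ⟨N, f, hf, -, hb⟩ := IsBounded.exists_common hP T hQ
  obtain ⟨y, hy⟩ := Quotient.exists_rep (f (starZ D P.l))
  -- The standard statement at `(n, f n)` becomes the statement at `(l, f l)`.
  have hgen := P.generic_transfer hP.generic (arith_noRelation T N) hf
    (fun n m _ => hP.noRelation_standard hT N n m) (y := y) hy.symm
  have hb' : ∀ᶠ k in (D : Filter Nat.Primes), ∀ t ∈ Finset.range T,
      ((size (Q t k) : ℤ) ≤ y k ∧ ((Q t k).natDegree : ℤ) ≤ N * P.l k ∧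
        ∀ r, (((Q t k).coeff r).natDegree : ℤ) ≤ N * P.l k) := by
    refine (Filter.eventually_all_finset _).2 fun t ht => ?_
    have h1 := (hb t (Finset.mem_range.1 ht))
    have h2 := h1.1
    rw [← hy] at h2
    exact (starZ_le_iff.1 h2).and h1.2
  have hsum : P.redHom (∑ t ∈ Finset.range T, (fun k => biEval (P.e k ^ (P.v k).toNat)
      (P.e k ^ (P.u k).toNat) (Q t k)) * P.i ^ t) = 0 := by
    rw [← h0, map_sum]
    refine Finset.sum_congr rfl fun t _ => ?_
    rw [map_mul, map_pow]
    rfl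
  intro t ht
  filter_upwards [hgen, hb', P.red_eq_zero_iff.1 hsum, hP.eventually_regular] with k hk hbk hsk hr r
  have hNl : 0 ≤ N * P.l k := mul_nonneg (Nat.cast_nonneg _) hr.l_pos.le
  obtain ⟨B, hB⟩ : ∃ B : ℕ, (B : ℤ) = N * P.l k + 1 := ⟨(N * P.l k + 1).toNat, by omega⟩
  -- The coded array consists of the coefficients of all the `Q t k`. Degrees at most `N * l` leave
  -- `B = N * l + 1` places in each variable.
  obtain ⟨c, d, w, hc⟩ := exists_entry_eq_triple (fun t r s => ((Q t k).coeff r).coeff s) T B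
  have heval : ∀ t < T, ∀ r < B, ∀ x : ℤ, ∑ s ∈ Finset.range B,
      entry c d w (((t : ℤ) * B + r) * B + s) * x ^ s = aeval x ((Q t k).coeff r) := by
    intro t ht r hr x
    rw [aeval_eq_sum_range' (n := B)]
    · refine Finset.sum_congr rfl fun s hs => ?_
      rw [hc t ht r hr s (Finset.mem_range.1 hs), smul_eq_mul]
    · have := (hbk t (Finset.mem_range.2 ht)).2.2 r
      omega
  have hk1 := hk (P.u k) hr.u_eq c d w
  simp only [params, ← hB, Int.toNat_natCast] at hk1
  rcases lt_or_ge r B with hrB | hrB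
  · have := hk1 ?_ ?_ t r ⟨⟨by omega, by omega⟩, by omega, by omega⟩
    · rw [heval t ht r hrB] at this
      exact this
    · rintro t r s ⟨⟨ht, ht'⟩, ⟨hr, hr'⟩, hs, hs'⟩
      lift t to ℕ using ht
      lift r to ℕ using hr
      lift s to ℕ using hs
      rw [hc t (by omega) r (by omega) s (by omega)]
      have := (hbk t (Finset.mem_range.2 (by omega))).1
      have := natAbs_coeff_le_size (Q t k) r s
      omega
    · simp only [Finset.sum_apply, Pi.mul_apply, Pi.pow_apply] at hsk
      convert hsk using 1
      simp only [Finset.sum_mul]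
      rw [Finset.sum_comm]
      refine Finset.sum_congr rfl fun t ht => ?_
      rw [biEval_eq_sum _ _ (n := B), Finset.sum_mul]
      · refine Finset.sum_congr rfl fun r hr => ?_
        rw [← heval t (Finset.mem_range.1 ht) r (Finset.mem_range.1 hr), Finset.sum_mul,
          Finset.sum_mul]
        refine Finset.sum_congr rfl fun s _ => ?_
        rw [v]
        ring
      · have := (hbk t ht).2.1
        omega
  · rw [coeff_eq_zero_of_natDegree_lt, map_zero]
    · exact dvd_zero _
    · have := (hbk t (Finset.mem_range.2 ht)).2.1
      omega

end Params

end PseudoFinite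

namespace PseudoFinite

open Polynomial

theorem intCast_aeval {R : Type*} [CommRing R] (x : ℤ) (p : ℤ[X]) :
    ((aeval x p : ℤ) : R) = aeval (x : R) p := by
  have := hom_eval₂ p (algebraMap ℤ ℤ) (Int.castRingHom R) x
  rw [← aeval_def, eq_intCast, eq_intCast] at this
  rw [this, aeval_def]
  congr 1

namespace Params

variable {D : Ultrafilter Nat.Primes} {P : Params D}

/-! ### The ring of bounded sequences of polynomials -/

theorem IsBounded.add (hP : P.Admissible) {Q Q' : Nat.Primes → ℤ[X][X]} (h : P.IsBounded Q)
    (h' : P.IsBounded Q') : P.IsBounded (Q + Q') := by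
  obtain ⟨N, f, hf, h1, h2⟩ := h
  obtain ⟨N', f', hf', h1', h2'⟩ := h'
  refine ⟨N + N', f + f', P.add_mem_funs hf hf', ?_, ?_⟩
  · refine le_trans ?_ (add_le_add h1 h1')
    refine starZ_le_iff.2 (Eventually.of_forall fun k => ?_)
    change (size (Q k + Q' k) : ℤ) ≤ size (Q k) + size (Q' k)
    exact_mod_cast isSize_size.add_le _ _
  · filter_upwards [h2, h2', hP.eventually_regular] with k hk hk' hr
    have h3 := mul_nonneg (Nat.cast_nonneg (α := ℤ) N) hr.l_pos.le
    have h4 := mul_nonneg (Nat.cast_nonneg (α := ℤ) N') hr.l_pos.le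
    rw [Nat.cast_add, add_mul]
    refine ⟨?_, fun r => ?_⟩
    · have := natDegree_add_le (Q k) (Q' k)
      have := hk.1
      have := hk'.1
      rw [Pi.add_apply]
      omega
    · have := natDegree_add_le ((Q k).coeff r) ((Q' k).coeff r)
      have := hk.2 r
      have := hk'.2 r
      rw [Pi.add_apply, coeff_add]
      omega

theorem IsBounded.mul {Q Q' : Nat.Primes → ℤ[X][X]} (h : P.IsBounded Q)
    (h' : P.IsBounded Q') : P.IsBounded (Q * Q') := by
  obtain ⟨N, f, hf, h1, h2⟩ := h
  obtain ⟨N', f', hf', h1', h2'⟩ := h'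
  refine ⟨N + N', f * f', P.mul_mem_funs hf hf', ?_, ?_⟩
  · obtain ⟨y, hy⟩ := Quotient.exists_rep (f (starZ D P.l))
    obtain ⟨y', hy'⟩ := Quotient.exists_rep (f' (starZ D P.l))
    rw [Pi.mul_apply]
    rw [← hy] at h1 ⊢
    rw [← hy'] at h1' ⊢
    refine starZ_le_iff.2 ?_
    filter_upwards [starZ_le_iff.1 h1, starZ_le_iff.1 h1'] with k hk hk'
    refine le_trans (b := ((size (Q k) * size (Q' k) : ℕ) : ℤ))
      (by exact_mod_cast isSize_size.mul_le _ _) ?_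
    rw [Nat.cast_mul]
    exact mul_le_mul hk hk' (Nat.cast_nonneg _) ((Nat.cast_nonneg _).trans hk)
  · filter_upwards [h2, h2'] with k hk hk'
    rw [Nat.cast_add, add_mul]
    refine ⟨?_, fun r => ?_⟩
    · have := natDegree_mul_le (p := Q k) (q := Q' k)
      have := hk.1
      have := hk'.1
      rw [Pi.mul_apply]
      omega
    · have h3 : (((Q k * Q' k).coeff r).natDegree) ≤ (N * P.l k + N' * P.l k).toNat := by
        rw [coeff_mul]
        refine natDegree_sum_le_of_forall_le _ _ fun x _ => ?_
        have := natDegree_mul_le (p := (Q k).coeff x.1) (q := (Q' k).coeff x.2)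
        have := hk.2 x.1
        have := hk'.2 x.2
        omega
      have := hk.2 r
      have := hk'.2 r
      rw [Pi.mul_apply]
      omega

theorem IsBounded.neg {Q : Nat.Primes → ℤ[X][X]} (h : P.IsBounded Q) : P.IsBounded (-Q) := by
  obtain ⟨N, f, hf, h1, h2⟩ := h
  refine ⟨N, f, hf, ?_, ?_⟩
  · simpa only [Pi.neg_apply, isSize_size.neg] using h1
  · simpa only [Pi.neg_apply, coeff_neg, natDegree_neg] using h2

theorem size_monomial (r s : ℕ) (a : ℤ) : size (monomial r (monomial s a)) = a.natAbs := by
  rw [size, IsSize.natAbs.coeffSize.coeffSize_monomial, IsSize.natAbs.coeffSize_monomial]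

theorem natDegree_coeff_monomial_le (r s r' : ℕ) (a : ℤ) :
    ((monomial r (monomial s a)).coeff r').natDegree ≤ s := by
  rw [coeff_monomial]
  split_ifs
  · exact natDegree_monomial_le _
  · simp

theorem IsBounded.of_intCast (a : ℤ) : P.IsBounded fun _ => (a : ℤ[X][X]) := by
  refine ⟨0, _, P.natCast_mem_funs a.natAbs, ?_, ?_⟩
  · refine starZ_le_iff (y := fun _ => (a.natAbs : ℤ)).2 (Eventually.of_forall fun k => ?_)
    have := size_monomial 0 0 a
    rw [monomial_zero_left, monomial_zero_left, eq_intCast, map_intCast] at this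
    exact_mod_cast this.le
  · filter_upwards with k
    refine ⟨by simp, fun r => ?_⟩
    have := natDegree_coeff_monomial_le 0 0 r a
    rw [monomial_zero_left, monomial_zero_left] at this
    simpa using this

/-- The ring of bounded sequences of polynomials in two variables. -/
def boundedSubring (hP : P.Admissible) : Subring (Nat.Primes → ℤ[X][X]) where
  carrier := {Q | P.IsBounded Q}
  mul_mem' := IsBounded.mul
  one_mem' := by simpa using! IsBounded.of_intCast 1
  add_mem' := IsBounded.add hP
  zero_mem' := by simpa using! IsBounded.of_intCast 0
  neg_mem' := IsBounded.neg

/-! ### Values in `F_p` and in `*ℂ` -/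

variable (P)

/-- The root of unity `exp(-2πi / l)`. -/
noncomputable def zeta (k : Nat.Primes) : ℂ := Complex.exp (-(2 * Real.pi * Complex.I / P.l k))

/-- The number `exp(-2π' / l)`. -/
noncomputable def expReal (k : Nat.Primes) : ℂ := Complex.exp (-(2 * P.ϖ k / P.l k))

/-- The value in `*ℂ` of a sequence of polynomials. -/
noncomputable def evalC : (Nat.Primes → ℤ[X][X]) →+* StarC D :=
  (Germ.coeRingHom (D : Filter Nat.Primes)).comp
    (RingHom.pi fun k => (biEval (P.zeta k) (P.expReal k)).comp (Pi.evalRingHom _ k))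

theorem evalC_apply (Q : Nat.Primes → ℤ[X][X]) :
    P.evalC Q = starC D fun k => biEval (P.zeta k) (P.expReal k) (Q k) := rfl

variable {P}

theorem Regular.natCast_toNat_l {k : Nat.Primes} (hk : P.Regular k) :
    ((P.l k).toNat : ℂ) = P.l k := by
  rw [← Int.cast_natCast, Int.toNat_of_nonneg hk.l_pos.le]

theorem Regular.isPrimitiveRoot_zeta {k : Nat.Primes} (hk : P.Regular k) :
    IsPrimitiveRoot (P.zeta k) (P.l k).toNat := by
  have h := (Complex.isPrimitiveRoot_exp (P.l k).toNat (by have := hk.l_pos; omega)).inv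
  rw [← Complex.exp_neg] at h
  rw [zeta, ← hk.natCast_toNat_l]
  exact h

/-- The inverse of the `l`-th power of `exp(-2π'/l)` is the square of `exp(π')`. -/
theorem Regular.transcendental_expReal {k : Nat.Primes} (hk : P.Regular k) :
    Transcendental ℚ (P.expReal k) := by
  intro h
  refine hk.transc ?_
  have hl : (P.l k : ℂ) ≠ 0 := by exact_mod_cast hk.l_pos.ne'
  have h1 : (P.expReal k ^ (P.l k).toNat)⁻¹ = (Real.exp (P.ϖ k) : ℂ) ^ 2 := by
    rw [expReal, ← Complex.exp_nat_mul, hk.natCast_toNat_l, ← Complex.exp_neg, Complex.ofReal_exp,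
      ← Complex.exp_nat_mul]
    congr 1
    push_cast
    field_simp
  have h3 : IsAlgebraic ℚ ((Real.exp (P.ϖ k) : ℂ) ^ 2) := h1 ▸ (h.pow _).inv
  have h4 : IsAlgebraic ℚ (Real.exp (P.ϖ k) : ℂ) := h3.of_pow two_pos
  exact (isAlgebraic_algebraMap_iff (algebraMap ℝ ℂ).injective).1 h4

theorem Admissible.evalC_eq_zero_iff (hP : P.Admissible) (Q : Nat.Primes → ℤ[X][X]) :
    P.evalC Q = 0 ↔
      ∀ᶠ k in (D : Filter Nat.Primes), ∀ r, aeval (P.zeta k) ((Q k).coeff r) = 0 := by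
  refine (starC_eq_iff (y := fun _ => 0)).trans (eventually_congr ?_)
  filter_upwards [hP.eventually_regular] with k hk
  refine biEval_eq_zero_iff_of_transcendental ?_ hk.transcendental_expReal _
  have := hk.l_pos
  exact ((hk.isPrimitiveRoot_zeta.isIntegral (by omega)).tower_top (A := ℚ)).isAlgebraic

theorem Admissible.evalF_eq_zero_iff (hP : P.Admissible) {Q : Nat.Primes → ℤ[X][X]}
    (hQ : P.IsBounded Q) :
    P.evalF Q = 0 ↔ ∀ᶠ k in (D : Filter Nat.Primes),
      ∀ r, P.p k ∣ aeval (P.e k ^ (P.v k).toNat) ((Q k).coeff r) := by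
  constructor
  · intro h
    exact hP.dvd_of_sum_evalF_eq_zero (T := 1) (Or.inl rfl) (Q := fun _ => Q) (fun _ _ => hQ)
      (by simpa using h) 0 one_pos
  · intro h
    rw [evalF_apply, red_eq_zero_iff]
    filter_upwards [h] with k hk
    rw [biEval_eq_sum _ _ (Nat.lt_succ_self _)]
    exact Finset.dvd_sum fun r _ => (hk r).mul_right _

/-- For standard `m, n` one has `m ^ n < p` because `p` is infinite; genericity gives `f(l) ^ l <
p`. This is the room that the resultant argument needs. -/
theorem Admissible.size_pow_lt (hP : P.Admissible) {Q : Nat.Primes → ℤ[X][X]}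
    (hQ : P.IsBounded Q) :
    ∀ᶠ k in (D : Filter Nat.Primes), (size (Q k) : ℤ) ^ (P.l k).toNat < P.p k := by
  obtain ⟨N, f, hf, h1, -⟩ := hQ
  obtain ⟨y, hy⟩ := Quotient.exists_rep (f (starZ D P.l))
  have h := P.generic_transfer hP.generic (R := fun v => v 1 ^ (v 0).toNat < v 2)
    (.lt (.pow (.var 1) (.var 0)) (.var 2)) hf (fun n m _ => by
      filter_upwards [hP.eventually_regular, hP.le_l (m ^ n)] with k hk hk'
      have := hk.l_lt
      simp only [params, Int.toNat_natCast]
      push_cast at hk'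
      omega) (y := y) hy.symm
  rw [← hy] at h1
  filter_upwards [h, starZ_le_iff.1 h1] with k hk hk'
  exact (pow_le_pow_left₀ (Nat.cast_nonneg _) hk' _).trans_lt hk

/-- On both sides the outer variable has been eliminated, leaving one-variable polynomials at
primitive `l`-th roots of unity, in `ZMod p` and in `ℂ`. -/
theorem Admissible.evalF_eq_zero_iff_evalC_eq_zero (hP : P.Admissible)
    {Q : Nat.Primes → ℤ[X][X]} (hQ : P.IsBounded Q) : P.evalF Q = 0 ↔ P.evalC Q = 0 := by
  rw [hP.evalF_eq_zero_iff hQ, hP.evalC_eq_zero_iff]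
  refine eventually_congr ?_
  filter_upwards [hP.eventually_regular, hP.size_pow_lt hQ] with k hk hs
  refine forall_congr' fun r => ?_
  have := Fact.mk hk.prime
  have hl : 0 < (P.l k).toNat := by have := hk.l_pos; omega
  rw [← intCast_zmod_eq_zero_iff hk.prime, intCast_aeval]
  constructor
  · intro h
    by_contra hc
    refine aeval_primitiveRoot_ne_zero (q := (P.p k).toNat) hl hk.isPrimitiveRoot_pow_v
      hk.isPrimitiveRoot_zeta ?_ hc h
    have h1 := Nat.pow_le_pow_left (coeffSize_coeff_le_size (Q k) r) (P.l k).toNat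
    refine h1.trans_lt ?_
    rw [← Nat.cast_lt (α := ℤ), Int.toNat_of_nonneg (by have := hk.two_le; omega)]
    exact_mod_cast hs
  · exact aeval_primitiveRoot_eq_zero hl hk.isPrimitiveRoot_pow_v hk.isPrimitiveRoot_zeta

end Params

end PseudoFinite

namespace PseudoFinite

open Polynomial

/-! ### Extension of a homomorphism to a field of fractions -/

/-- Equal kernels give an injection of the image of `φ` into `L`. It extends to the fraction field
of that image, and the copy of this fraction field in `K` contains the field closure. -/
theorem exists_ringHom_closure_range {G K L : Type*} [CommRing G] [Field K] [Field L] (φ : G →+* K)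
    (ψ : G →+* L) (h : ∀ x, φ x = 0 ↔ ψ x = 0) :
    ∃ I : Subfield.closure (Set.range φ) →+* L,
      ∀ x, I ⟨φ x, Subfield.subset_closure ⟨x, rfl⟩⟩ = ψ x := by
  let ψ' : G ⧸ RingHom.ker φ →+* L := Ideal.Quotient.lift _ ψ fun x hx => (h x).1 hx
  let i : φ.range →+* L := ψ'.comp (RingHom.quotientKerEquivRange φ).symm.toRingHom
  have hi : ∀ x, i ⟨φ x, x, rfl⟩ = ψ x := by
    intro x
    have : (RingHom.quotientKerEquivRange φ).symm ⟨φ x, x, rfl⟩ = Ideal.Quotient.mk _ x := by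
      rw [RingEquiv.symm_apply_eq]
      rfl
    change ψ' ((RingHom.quotientKerEquivRange φ).symm ⟨φ x, x, rfl⟩) = _
    rw [this]
    rfl
  have hinj : Function.Injective i := by
    rw [injective_iff_map_eq_zero]
    rintro ⟨_, x, rfl⟩ hx
    rw [hi] at hx
    exact Subtype.ext ((h x).2 hx)
  let a : FractionRing φ.range →+* K := IsFractionRing.lift (g := φ.range.subtype)
    Subtype.val_injective
  let b : FractionRing φ.range →+* L := IsFractionRing.lift hinj
  let e : FractionRing φ.range ≃+* a.fieldRange := RingEquiv.ofBijective a.rangeRestrictField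
    ⟨fun x y hxy => a.injective (congrArg Subtype.val hxy), by
      rintro ⟨_, x, rfl⟩
      exact ⟨x, rfl⟩⟩
  have ha : ∀ x, a (algebraMap _ _ (⟨φ x, x, rfl⟩ : φ.range)) = φ x := fun x =>
    IsFractionRing.lift_algebraMap _ _
  have hle : Subfield.closure (Set.range φ) ≤ a.fieldRange := by
    rw [Subfield.closure_le]
    rintro _ ⟨x, rfl⟩
    exact ⟨_, ha x⟩
  refine ⟨(b.comp e.symm.toRingHom).comp (Subfield.inclusion hle), fun x => ?_⟩
  have h1 : e.symm (Subfield.inclusion hle ⟨φ x, Subfield.subset_closure ⟨x, rfl⟩⟩) =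
      algebraMap _ _ (⟨φ x, x, rfl⟩ : φ.range) := by
    rw [RingEquiv.symm_apply_eq]
    exact Subtype.ext (ha x).symm
  change b (e.symm _) = _
  rw [h1]
  exact (IsFractionRing.lift_algebraMap hinj _).trans (hi x)

namespace Params

variable {D : Ultrafilter Nat.Primes} {P : Params D}

/-! ### Families and polynomials -/

theorem exists_argmax (I : Nat.Primes → Finset ℤ) (x : Nat.Primes → ℤ → ℤ) :
    ∃ t : Nat.Primes → ℤ, ∀ k, (I k).Nonempty → t k ∈ I k ∧ ∀ t' ∈ I k, |x k t'| ≤ |x k (t k)| := by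
  have : ∀ k, ∃ t, (I k).Nonempty → t ∈ I k ∧ ∀ t' ∈ I k, |x k t'| ≤ |x k t| := by
    intro k
    rcases (I k).eq_empty_or_nonempty with h | h
    · exact ⟨0, fun h' => absurd h h'.ne_empty⟩
    · obtain ⟨t, ht, ht'⟩ := (I k).exists_max_image (fun t => |x k t|) h
      exact ⟨t, fun _ => ⟨ht, ht'⟩⟩
  choose t ht using this
  exact ⟨t, ht⟩

/-- `Good` bounds each internal index separately. Applied to an index chosen at every coordinate to
maximise `|a_t|` or `|r_t|`, it yields a uniform bound. -/
theorem Good.exists_bound (A : Family) (hA : P.Good A) : ∃ (n : ℕ) (f : StarZ D → StarZ D)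
    (y : Nat.Primes → ℤ), f ∈ P.funs ∧ f (starZ D P.l) = starZ D y ∧
    ∀ᶠ k in (D : Filter Nat.Primes), 0 ≤ y k ∧ ∀ t ∈ A.I k, |A.a k t| ≤ y k ∧
      |A.r k t| ≤ n * P.l k := by
  rcases Ultrafilter.em D (fun k => (A.I k).Nonempty) with h | h
  · obtain ⟨t, ht⟩ := exists_argmax A.I A.a
    obtain ⟨t', ht'⟩ := exists_argmax A.I A.r
    obtain ⟨⟨f, hf, h1, h2⟩, -, -⟩ := hA.2 t (h.mono fun k hk => (ht k hk).1)
    obtain ⟨-, ⟨n, h3, h4⟩, -⟩ := hA.2 t' (h.mono fun k hk => (ht' k hk).1)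
    obtain ⟨y, hy⟩ := Quotient.exists_rep (f (starZ D P.l))
    refine ⟨n, f, y, hf, hy.symm, ?_⟩
    rw [← hy] at h1 h2
    filter_upwards [h, starZ_le_iff.1 h1, starZ_le_iff.1 h2, starZ_le_iff.1 h3,
      starZ_le_iff.1 h4] with k hk h1 h2 h3 h4
    change -y k ≤ _ at h1
    change -(n * P.l k) ≤ _ at h3
    change _ ≤ n * P.l k at h4
    exact ⟨(abs_nonneg _).trans (abs_le.2 ⟨h1, h2⟩), fun s hs =>
      ⟨((ht k hk).2 s hs).trans (abs_le.2 ⟨h1, h2⟩),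
        ((ht' k hk).2 s hs).trans (abs_le.2 ⟨h3, h4⟩)⟩⟩
  · refine ⟨0, 1, 1, P.one_mem_funs, rfl, ?_⟩
    filter_upwards [h] with k hk
    rw [Finset.not_nonempty_iff_eq_empty] at hk
    simp [hk]

/-- The polynomials attached to a family, with the exponents `r` shifted by `n * l`. -/
noncomputable def familyPoly (P : Params D) (A : Family) (n : ℕ) (k : Nat.Primes) : ℤ[X][X] :=
  ∑ t ∈ A.I k, monomial (A.r k t + n * P.l k).toNat
    (monomial (A.s k t % P.l k).toNat (A.a k t))

/-- The monomial that represents `exp_p(n * l * u)`. -/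
noncomputable def shiftPoly (P : Params D) (n : ℕ) (k : Nat.Primes) : ℤ[X][X] :=
  monomial (n * P.l k).toNat (monomial 0 1)

theorem Admissible.isBounded_shiftPoly (hP : P.Admissible) (n : ℕ) :
    P.IsBounded (P.shiftPoly n) := by
  refine ⟨n, 1, P.one_mem_funs, ?_, ?_⟩
  · refine starZ_le_iff (y := fun _ => 1).2 (Eventually.of_forall fun k => ?_)
    rw [shiftPoly, size_monomial]
    simp
  · filter_upwards [hP.eventually_regular] with k hk
    have h0 : 0 ≤ n * P.l k := mul_nonneg (Nat.cast_nonneg _) hk.l_pos.le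
    refine ⟨?_, fun r => ?_⟩
    · have := natDegree_monomial_le (monomial 0 (1 : ℤ)) (m := (n * P.l k).toNat)
      rw [shiftPoly]
      omega
    · have := natDegree_coeff_monomial_le (n * P.l k).toNat 0 r 1
      rw [shiftPoly]
      omega

theorem Admissible.isBounded_familyPoly (hP : P.Admissible) {A : Family} {n M : ℕ}
    (hM : ∀ᶠ k in (D : Filter Nat.Primes), A.I k ⊆ Finset.Icc 0 (P.l k ^ M))
    {f : StarZ D → StarZ D} {y : Nat.Primes → ℤ} (hf : f ∈ P.funs)
    (hy : f (starZ D P.l) = starZ D y)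
    (h : ∀ᶠ k in (D : Filter Nat.Primes), 0 ≤ y k ∧ ∀ t ∈ A.I k, |A.a k t| ≤ y k ∧
      |A.r k t| ≤ n * P.l k) : P.IsBounded (P.familyPoly A n) := by
  -- There are at most `l ^ M + 1` terms, each coefficient being at most `f(l)`. Shifted exponents
  -- `r` are at most `2 n l`, and reduced exponents `s` are below `l`.
  refine ⟨2 * n + 1, (id ^ M + 1) * f, P.mul_mem_funs (P.add_mem_funs
    (P.pow_mem_funs P.id_mem_funs M) P.one_mem_funs) hf, ?_, ?_⟩
  · have h1 : ((id ^ M + 1) * f : StarZ D → StarZ D) (starZ D P.l) = starZ D fun k => (P.l k ^ M + 1) * y k := by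
      rw [Pi.mul_apply, hy]
      rfl
    rw [h1]
    refine starZ_le_iff.2 ?_
    filter_upwards [hM, h, hP.eventually_regular] with k hMk hk hr
    have h2 : (size (P.familyPoly A n k) : ℤ) ≤ ∑ t ∈ A.I k, |A.a k t| := by
      have := isSize_size.sum_le (A.I k) fun t => (monomial (A.r k t + n * P.l k).toNat
        (monomial (A.s k t % P.l k).toNat (A.a k t)))
      simp only [size_monomial] at this
      rw [familyPoly]
      refine (Nat.cast_le.2 this).trans (le_of_eq ?_)
      push_cast
      rfl
    refine h2.trans ((Finset.sum_le_card_nsmul _ _ _ fun t ht => (hk.2 t ht).1).trans ?_)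
    rw [nsmul_eq_mul]
    refine mul_le_mul_of_nonneg_right ?_ hk.1
    have h3 := Finset.card_le_card hMk
    rw [Int.card_Icc] at h3
    have := pow_pos hr.l_pos M
    omega
  · filter_upwards [h, hP.eventually_regular] with k hk hr
    have h0 : 0 ≤ n * P.l k := mul_nonneg (Nat.cast_nonneg _) hr.l_pos.le
    have hN : ((2 * n + 1 : ℕ) : ℤ) * P.l k = 2 * (n * P.l k) + P.l k := by push_cast; ring
    have hl := hr.l_pos
    rw [hN]
    refine ⟨?_, fun r => ?_⟩
    · have : (P.familyPoly A n k).natDegree ≤ (2 * (n * P.l k)).toNat := by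
        refine natDegree_sum_le_of_forall_le _ _ fun t ht => (natDegree_monomial_le _).trans ?_
        have := abs_le.1 (hk.2 t ht).2
        omega
      omega
    · have : ((P.familyPoly A n k).coeff r).natDegree ≤ (P.l k).toNat := by
        rw [familyPoly, finsetSum_coeff]
        refine natDegree_sum_le_of_forall_le _ _ fun t ht =>
          (natDegree_coeff_monomial_le _ _ _ _).trans ?_
        have := Int.emod_lt_of_pos (A.s k t) hl
        omega
      omega

/-- The shift makes the exponents of `exp_p(u)` nonnegative, while those of `exp_p(v)` may be
reduced modulo `l` because `v * l = p - 1`. -/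
theorem Admissible.sumF_mul (hP : P.Admissible) {A : Family} {n : ℕ}
    (h : ∀ᶠ k in (D : Filter Nat.Primes), ∀ t ∈ A.I k, |A.r k t| ≤ n * P.l k) :
    P.sumF A * P.evalF (P.shiftPoly n) = P.evalF (P.familyPoly A n) := by
  rw [evalF_apply, evalF_apply, sumF, ← redHom_apply, ← redHom_apply, ← map_mul, redHom_apply]
  refine P.red_eq_red_iff.2 ?_
  filter_upwards [h, hP.eventually_regular] with k hk hr
  rw [← intCast_zmod_eq_zero_iff hr.prime, Int.cast_sub, sub_eq_zero, Pi.mul_apply, familyPoly,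
    map_sum, Finset.sum_mul, Int.cast_sum, Int.cast_sum]
  refine Finset.sum_congr rfl fun t ht => ?_
  rw [shiftPoly, biEval_monomial, biEval_monomial]
  have h0 : 0 ≤ n * P.l k := mul_nonneg (Nat.cast_nonneg _) hr.l_pos.le
  have h1 := abs_le.1 (hk t ht)
  have hs : (P.expCoord (fun k' => A.s k' t * P.v k') k : ZMod (P.p k).toNat) =
      (P.e k : ZMod (P.p k).toNat) ^ ((P.v k).toNat * (A.s k t % P.l k).toNat) := by
    refine hr.expCoord_eq_pow ?_
    rw [Nat.cast_mul, Int.toNat_of_nonneg hr.v_pos.le,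
      Int.toNat_of_nonneg (Int.emod_nonneg _ hr.l_pos.ne'), mul_comm, ← mul_sub, ← hr.v_mul]
    exact mul_dvd_mul_left _ Int.dvd_self_sub_emod
  have hu : (P.expCoord (fun k' => A.r k' t * P.u k') k : ZMod (P.p k).toNat) *
      (P.e k : ZMod (P.p k).toNat) ^ ((P.u k).toNat * (n * P.l k).toNat) =
      (P.e k : ZMod (P.p k).toNat) ^ ((P.u k).toNat * (A.r k t + n * P.l k).toNat) := by
    rw [expCoord, Int.cast_pow, ← pow_add]
    refine hr.pow_eq_pow ?_
    rw [Nat.cast_add, Int.toNat_of_nonneg (Int.emod_nonneg _ (by have := hr.two_le; omega)),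
      Nat.cast_mul, Nat.cast_mul, Int.toNat_of_nonneg hr.u_pos.le, Int.toNat_of_nonneg h0,
      Int.toNat_of_nonneg (by omega), ← dvd_neg]
    have := Int.dvd_self_sub_emod (x := A.r k t * P.u k) (m := P.p k - 1)
    have h2 : ∀ z : ℤ, -(z + P.u k * (n * P.l k) - P.u k * (A.r k t + n * P.l k)) =
        A.r k t * P.u k - z := fun z => by ring
    rwa [h2]
  push_cast
  rw [hs, ← pow_mul, ← pow_mul, ← pow_mul, ← pow_mul, ← hu]
  ring

theorem expReal_zpow (k : Nat.Primes) (r : ℤ) :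
    P.expReal k ^ r = Complex.exp (-(2 * (r : ℂ) * (P.ϖ k : ℂ) / (P.l k : ℂ))) := by
  rw [expReal, ← Complex.exp_int_mul]
  congr 1
  ring

theorem zeta_zpow (k : Nat.Primes) (s : ℤ) : P.zeta k ^ s =
    Complex.exp (-(2 * (s : ℂ) * (Real.pi : ℂ) * Complex.I / (P.l k : ℂ))) := by
  rw [zeta, ← Complex.exp_int_mul]
  congr 1
  ring

theorem Admissible.sumC_mul (hP : P.Admissible) {A : Family} {n : ℕ}
    (h : ∀ᶠ k in (D : Filter Nat.Primes), ∀ t ∈ A.I k, |A.r k t| ≤ n * P.l k) :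
    P.sumC A * P.evalC (P.shiftPoly n) = P.evalC (P.familyPoly A n) := by
  rw [evalC_apply, evalC_apply, sumC]
  refine starC_eq_iff.2 ?_
  filter_upwards [h, hP.eventually_regular] with k hk hr
  rw [familyPoly, map_sum, Finset.sum_mul]
  refine Finset.sum_congr rfl fun t ht => ?_
  have h0 : 0 ≤ n * P.l k := mul_nonneg (Nat.cast_nonneg _) hr.l_pos.le
  have h1 := abs_le.1 (hk t ht)
  have hz : P.zeta k ^ P.l k = 1 := by
    have := hr.isPrimitiveRoot_zeta.pow_eq_one
    rwa [← zpow_natCast, Int.toNat_of_nonneg hr.l_pos.le] at this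
  have hE : P.expReal k ≠ 0 := Complex.exp_ne_zero _
  have hZ : P.zeta k ≠ 0 := Complex.exp_ne_zero _
  rw [shiftPoly, biEval_monomial, biEval_monomial, ← expReal_zpow, ← zeta_zpow, pow_zero,
    ← zpow_natCast (P.expReal k), ← zpow_natCast (P.expReal k), ← zpow_natCast (P.zeta k),
    Int.toNat_of_nonneg h0, Int.toNat_of_nonneg (a := A.r k t + n * P.l k) (by omega),
    Int.toNat_of_nonneg (Int.emod_nonneg _ hr.l_pos.ne'), zpow_add₀ hE]
  have h2 : P.zeta k ^ A.s k t = P.zeta k ^ (A.s k t % P.l k) := by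
    conv_lhs => rw [← Int.emod_add_mul_ediv (A.s k t) (P.l k)]
    rw [zpow_add₀ hZ, zpow_mul, hz, one_zpow, mul_one]
  rw [h2]
  push_cast
  ring

theorem evalC_shiftPoly_ne_zero (n : ℕ) :
    P.evalC (P.shiftPoly n) ≠ 0 := by
  rw [evalC_apply]
  intro h
  obtain ⟨k, hk⟩ := (starC_eq_iff (y := fun _ => 0).1 h).exists
  rw [shiftPoly, biEval_monomial] at hk
  simp [expReal, Complex.exp_ne_zero] at hk

/-- The field of fractions of the values of bounded sequences of polynomials. -/
noncomputable def fracField (hP : P.Admissible) : Subfield P.Fp :=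
  Subfield.closure (Set.range (P.evalF.comp (boundedSubring hP).subtype))

/-- A single pair of numerator and denominator represents both the sum in `F_p` and the sum in `*ℂ`,
so the map on values of polynomials determines the required values on `O(F)`. -/
theorem Good.exists_isBounded (hP : P.Admissible) {A : Family} (hA : P.Good A) :
    ∃ Q W, P.IsBounded Q ∧ P.IsBounded W ∧ P.evalF W ≠ 0 ∧ P.evalC W ≠ 0 ∧
      P.sumF A * P.evalF W = P.evalF Q ∧ P.sumC A * P.evalC W = P.evalC Q := by
  obtain ⟨n, f, y, hf, hy, hb⟩ := Good.exists_bound A hA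
  obtain ⟨M, hM⟩ := hA.1
  have hr : ∀ᶠ k in (D : Filter Nat.Primes), ∀ t ∈ A.I k, |A.r k t| ≤ n * P.l k :=
    hb.mono fun k hk t ht => (hk.2 t ht).2
  have h0 := evalC_shiftPoly_ne_zero (P := P) n
  exact ⟨_, _, hP.isBounded_familyPoly hM hf hy hb, hP.isBounded_shiftPoly n,
    fun h => h0 ((hP.evalF_eq_zero_iff_evalC_eq_zero (hP.isBounded_shiftPoly n)).1 h), h0,
    hP.sumF_mul hr, hP.sumC_mul hr⟩

theorem Admissible.evalF_mem_fracField (hP : P.Admissible) {Q : Nat.Primes → ℤ[X][X]}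
    (hQ : P.IsBounded Q) : P.evalF Q ∈ fracField hP :=
  Subfield.subset_closure ⟨⟨Q, hQ⟩, rfl⟩

theorem Admissible.F_le_fracField (hP : P.Admissible) : P.F ≤ fracField hP := by
  refine Subfield.closure_le.2 ?_
  rintro _ ⟨A, hA, rfl⟩
  obtain ⟨Q, W, hQ, hW, hW0, -, h1, -⟩ := hA.exists_isBounded hP
  rw [eq_div_of_mul_eq hW0 h1]
  exact div_mem (hP.evalF_mem_fracField hQ) (hP.evalF_mem_fracField hW)

theorem Admissible.exists_isEmbeddingIF (hP : P.Admissible) :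
    ∃ I : P.F →+* StarC D, P.IsEmbeddingIF I := by
  obtain ⟨I, hI⟩ := exists_ringHom_closure_range (P.evalF.comp (boundedSubring hP).subtype)
    (P.evalC.comp (boundedSubring hP).subtype)
    fun Q => hP.evalF_eq_zero_iff_evalC_eq_zero Q.2
  refine ⟨I.comp (Subfield.inclusion hP.F_le_fracField), fun A hA => ?_⟩
  obtain ⟨Q, W, hQ, hW, -, hW0, h1, h2⟩ := hA.exists_isBounded hP
  have h3 := hI ⟨Q, hQ⟩
  have h4 := hI ⟨W, hW⟩
  refine mul_right_cancel₀ hW0 ?_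
  rw [h2]
  change _ * (P.evalC.comp (boundedSubring hP).subtype) ⟨W, hW⟩ =
    (P.evalC.comp (boundedSubring hP).subtype) ⟨Q, hQ⟩
  rw [← h3, ← h4, RingHom.comp_apply, ← map_mul]
  exact congrArg I (Subtype.ext h1)

theorem IsEmbeddingIF.unique {I I' : P.F →+* StarC D} (h : P.IsEmbeddingIF I)
    (h' : P.IsEmbeddingIF I') : I = I' := by
  have key : ∀ (x : P.Fp) (hx : x ∈ P.F), I ⟨x, hx⟩ = I' ⟨x, hx⟩ := by
    intro x hx
    induction hx using Subfield.closure_induction with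
    | mem x hx =>
      obtain ⟨A, hA, rfl⟩ := hx
      exact (h A hA).trans (h' A hA).symm
    | one => exact (map_one I).trans (map_one I').symm
    | add x y hx hy ihx ihy =>
      exact (map_add I ⟨x, hx⟩ ⟨y, hy⟩).trans
        ((congrArg₂ _ ihx ihy).trans (map_add I' ⟨x, hx⟩ ⟨y, hy⟩).symm)
    | neg x hx ih =>
      exact (map_neg I ⟨x, hx⟩).trans ((congrArg _ ih).trans (map_neg I' ⟨x, hx⟩).symm)
    | inv x hx ih =>
      exact (map_inv₀ I ⟨x, hx⟩).trans ((congrArg _ ih).trans (map_inv₀ I' ⟨x, hx⟩).symm)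
    | mul x y hx hy ihx ihy =>
      exact (map_mul I ⟨x, hx⟩ ⟨y, hy⟩).trans
        ((congrArg₂ _ ihx ihy).trans (map_mul I' ⟨x, hx⟩ ⟨y, hy⟩).symm)
  exact RingHom.ext fun x => key x x.2

end Params

end PseudoFinite

namespace PseudoFinite

variable {D : Ultrafilter Nat.Primes}

/-! ### Standard parts -/

/-- The standard complex number `c` is infinitely close to `z`. -/
def Near (z : StarC D) (c : ℂ) : Prop := Infinitesimal (z - stdC D c)

theorem near_starC_iff {x : Nat.Primes → ℂ} {c : ℂ} :
    Near (starC D x) c ↔ Tendsto x D (𝓝 c) := by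
  rw [Metric.tendsto_nhds]
  simp only [dist_eq_norm]
  exact Iff.rfl

theorem exists_starC_eq (z : StarC D) : ∃ x, starC D x = z := Quotient.exists_rep z

namespace Near

variable {z w : StarC D} {c d : ℂ}

theorem unique (h : Near z c) (h' : Near z d) : c = d := by
  obtain ⟨x, rfl⟩ := exists_starC_eq z
  exact tendsto_nhds_unique (near_starC_iff.1 h) (near_starC_iff.1 h')

theorem add (h : Near z c) (h' : Near w d) : Near (z + w) (c + d) := by
  obtain ⟨x, rfl⟩ := exists_starC_eq z
  obtain ⟨y, rfl⟩ := exists_starC_eq w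
  exact near_starC_iff.2 ((near_starC_iff.1 h).add (near_starC_iff.1 h'))

theorem mul (h : Near z c) (h' : Near w d) : Near (z * w) (c * d) := by
  obtain ⟨x, rfl⟩ := exists_starC_eq z
  obtain ⟨y, rfl⟩ := exists_starC_eq w
  exact near_starC_iff.2 ((near_starC_iff.1 h).mul (near_starC_iff.1 h'))

theorem neg (h : Near z c) : Near (-z) (-c) := by
  obtain ⟨x, rfl⟩ := exists_starC_eq z
  exact near_starC_iff.2 (near_starC_iff.1 h).neg

theorem std (c : ℂ) : Near (stdC D c) c := near_starC_iff.2 tendsto_const_nhds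

theorem st_eq (h : Near z c) : st z = (c : OnePoint ℂ) := by
  have h' : ∃ c : ℂ, Infinitesimal (z - stdC D c) := ⟨c, h⟩
  rw [st, dif_pos h', Near.unique (z := z) h'.choose_spec h]

end Near

theorem st_eq_infty {z : StarC D} (h : ¬∃ c, Near z c) : st z = OnePoint.infty := dif_neg h

/-- A bounded sequence converges along the ultrafilter by compactness of a closed disc; otherwise
its norm tends to infinity along the ultrafilter. The dichotomy gives the valuation ring property of
the finite elements. -/
theorem near_or_near_inv (z : StarC D) : (∃ c, Near z c) ∨ ∃ c, Near z⁻¹ c := by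
  obtain ⟨x, rfl⟩ := exists_starC_eq z
  by_cases h : ∃ C : ℝ, ∀ᶠ k in (D : Filter Nat.Primes), ‖x k‖ ≤ C
  · obtain ⟨C, hC⟩ := h
    left
    obtain ⟨c, -, hc⟩ := (isCompact_closedBall (0 : ℂ) C).ultrafilter_le_nhds (D.map x) (by
      rw [le_principal_iff]
      change ∀ᶠ k in (D : Filter Nat.Primes), x k ∈ Metric.closedBall 0 C
      filter_upwards [hC] with k hk
      simpa using hk)
    exact ⟨c, near_starC_iff.2 hc⟩
  · right
    push Not at h
    refine ⟨0, ?_⟩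
    have h1 : Tendsto (fun k => ‖x k‖) (D : Filter Nat.Primes) atTop := by
      refine tendsto_atTop.2 fun C => ?_
      exact (h C).mono fun k hk => hk.le
    exact (near_starC_iff (x := fun k => (x k)⁻¹)).2
      (tendsto_inv₀_cobounded.comp (tendsto_norm_atTop_iff_cobounded.1 h1))

/-- A homomorphism from a field to `*ℂ` followed by the standard part map is a place as soon as
every complex number is the standard part of an element of the image. -/
theorem isPlace_st_comp {K : Type*} [Field K] (J : K →+* StarC D)
    (hJ : ∀ c : ℂ, ∃ x, Near (J x) c) : IsPlace fun x => st (J x) := by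
  let V : ValuationSubring K :=
    { carrier := {x | ∃ c, Near (J x) c}
      mul_mem' := by
        rintro x y ⟨c, hc⟩ ⟨d, hd⟩
        exact ⟨c * d, by rw [map_mul]; exact hc.mul hd⟩
      one_mem' := ⟨1, by rw [map_one]; exact Near.std 1⟩
      add_mem' := by
        rintro x y ⟨c, hc⟩ ⟨d, hd⟩
        exact ⟨c + d, by rw [map_add]; exact hc.add hd⟩
      zero_mem' := ⟨0, by rw [map_zero]; exact Near.std 0⟩
      neg_mem' := by
        rintro x ⟨c, hc⟩
        exact ⟨-c, by rw [map_neg]; exact hc.neg⟩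
      mem_or_inv_mem' := fun x => by
        have := near_or_near_inv (J x)
        rwa [← map_inv₀] at this }
  choose lim hlim using fun x : V => x.2
  let ρ : V →+* ℂ :=
    { toFun := lim
      map_one' := (hlim 1).unique (by
        change Near (J 1) 1
        rw [map_one]
        exact Near.std 1)
      map_mul' := fun x y => (hlim (x * y)).unique (by
        change Near (J (x * y)) _
        rw [map_mul]
        exact (hlim x).mul (hlim y))
      map_zero' := (hlim 0).unique (by
        change Near (J 0) 0
        rw [map_zero]
        exact Near.std 0)
      map_add' := fun x y => (hlim (x + y)).unique (by
        change Near (J (x + y)) _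
        rw [map_add]
        exact (hlim x).add (hlim y)) }
  refine ⟨V, ρ, fun c => ?_, fun x => (hlim x).st_eq, fun x hx => st_eq_infty hx⟩
  obtain ⟨x, hx⟩ := hJ c
  exact ⟨⟨x, c, hx⟩, (hlim ⟨x, c, hx⟩).unique hx⟩

/-! ### `*ℂ` is algebraically closed and has a large transcendence degree -/

/-- Roots are chosen coordinatewise. For a monic polynomial the leading coefficient can be kept
equal to 1 at every coordinate, so the degree never drops. -/
instance isAlgClosed_starC : IsAlgClosed (StarC D) := by
  refine IsAlgClosed.of_exists_root _ fun p hp hirr => ?_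
  have hdeg : 0 < p.natDegree := hirr.natDegree_pos
  choose c hc using fun i => exists_starC_eq (p.coeff i)
  have hroot : ∀ k, ∃ x : ℂ, x ^ p.natDegree +
      ∑ i ∈ Finset.range p.natDegree, c i k * x ^ i = 0 := by
    intro k
    let q : Polynomial ℂ := ∑ i ∈ Finset.range p.natDegree, Polynomial.C (c i k) * Polynomial.X ^ i
    have hq : q.degree < (p.natDegree : WithBot ℕ) := by
      refine (Polynomial.degree_sum_le _ _).trans_lt ?_
      rw [Finset.sup_lt_iff (WithBot.bot_lt_coe _)]
      intro i hi
      refine (Polynomial.degree_C_mul_X_pow_le _ _).trans_lt ?_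
      exact_mod_cast Finset.mem_range.1 hi
    obtain ⟨x, hx⟩ := IsAlgClosed.exists_root (Polynomial.X ^ p.natDegree + q) (by
      rw [Polynomial.degree_add_eq_left_of_degree_lt (by rwa [Polynomial.degree_X_pow]),
        Polynomial.degree_X_pow]
      exact_mod_cast hdeg.ne')
    refine ⟨x, ?_⟩
    simpa [q, Polynomial.IsRoot.def, Polynomial.eval_finsetSum] using hx
  choose x hx using hroot
  refine ⟨starC D x, ?_⟩
  rw [hp.as_sum]
  simp only [Polynomial.eval_add, Polynomial.eval_pow, Polynomial.eval_X,
    Polynomial.eval_finsetSum, Polynomial.eval_mul, Polynomial.eval_C, ← hc]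
  have h1 : Germ.coeRingHom (D : Filter Nat.Primes) (x ^ p.natDegree +
      ∑ i ∈ Finset.range p.natDegree, c i * x ^ i) = 0 := by
    have : (x ^ p.natDegree + ∑ i ∈ Finset.range p.natDegree, c i * x ^ i) = 0 := by
      funext k
      simpa [Finset.sum_apply] using hx k
    rw [this, map_zero]
  simp only [map_add, map_sum, map_mul, map_pow] at h1
  exact h1

/-- The ultrapower of a subfield of `ℂ`. -/
def starSubfield (D : Ultrafilter Nat.Primes) (K : Subfield ℂ) : Subfield (StarC D) where
  carrier := {z | ∃ x : Nat.Primes → ℂ, (∀ k, x k ∈ K) ∧ starC D x = z}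
  mul_mem' := by
    rintro _ _ ⟨x, hx, rfl⟩ ⟨y, hy, rfl⟩
    exact ⟨x * y, fun k => mul_mem (hx k) (hy k), rfl⟩
  one_mem' := ⟨1, fun _ => one_mem K, rfl⟩
  add_mem' := by
    rintro _ _ ⟨x, hx, rfl⟩ ⟨y, hy, rfl⟩
    exact ⟨x + y, fun k => add_mem (hx k) (hy k), rfl⟩
  zero_mem' := ⟨0, fun _ => zero_mem K, rfl⟩
  neg_mem' := by
    rintro _ ⟨x, hx, rfl⟩
    exact ⟨-x, fun k => neg_mem (hx k), rfl⟩
  inv_mem' := by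
    rintro _ ⟨x, hx, rfl⟩
    exact ⟨x⁻¹, fun k => inv_mem (hx k), rfl⟩

/-- A polynomial over `*K` has finitely many monomials, so a relation over `*K` is, coordinate by
coordinate, a relation over `K` with the same exponents. -/
theorem algebraicIndependent_stdC {K : Subfield ℂ} {X : Type*} {y : X → ℂ}
    (hy : AlgebraicIndependent K y) :
    AlgebraicIndependent (starSubfield D K) fun x => stdC D (y x) := by
  classical
  rw [algebraicIndependent_iff]
  intro p hp
  choose r hr hr' using fun z : starSubfield D K => z.2
  let q : Nat.Primes → MvPolynomial X K := fun k =>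
    ∑ m ∈ p.support, MvPolynomial.monomial m ⟨r (p.coeff m) k, hr _ k⟩
  have hq : ∀ k, MvPolynomial.aeval y (q k) =
      ∑ m ∈ p.support, r (p.coeff m) k * ∏ i ∈ m.support, y i ^ m i := by
    intro k
    simp only [q, map_sum, MvPolynomial.aeval_monomial, Finsupp.prod]
    rfl
  have h1 : Germ.coeRingHom (D : Filter Nat.Primes) (∑ m ∈ p.support, r (p.coeff m) *
      ∏ i ∈ m.support, (fun _ => y i) ^ m i) = 0 := by
    rw [← hp, MvPolynomial.aeval_def, MvPolynomial.eval₂_eq]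
    simp only [map_sum, map_mul, map_prod, map_pow]
    refine Finset.sum_congr rfl fun m _ => congrArg (· * _) ?_
    exact hr' _
  have h2 : ∀ᶠ k in (D : Filter Nat.Primes), q k = 0 := by
    filter_upwards [(starC_eq_iff (y := fun _ => 0)).1 h1] with k hk
    refine (algebraicIndependent_iff.1 hy) _ ?_
    rw [hq, ← hk]
    simp [Finset.sum_apply, Finset.prod_apply]
  rw [← MvPolynomial.support_eq_empty, Finset.eq_empty_iff_forall_notMem]
  intro m hm
  refine (MvPolynomial.mem_support_iff.1 hm) (Subtype.ext ?_)
  rw [← hr']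
  refine (starC_eq_iff (y := fun _ => 0)).2 ?_
  filter_upwards [h2] with k hk
  have h3 := congrArg (MvPolynomial.coeff m) hk
  simp only [q, MvPolynomial.coeff_sum, MvPolynomial.coeff_monomial, MvPolynomial.coeff_zero] at h3
  rw [Finset.sum_ite_eq', if_pos hm] at h3
  exact congrArg Subtype.val h3

end PseudoFinite

namespace PseudoFinite

open Polynomial

/-! ### Algebraic elements and extensions of embeddings -/

theorem isAlgebraic_of_isAlgebraic_closure {K : Type*} [Field K] (S : Subring K) {x : K}
    (h : IsAlgebraic (Subfield.closure (S : Set K)) x) : IsAlgebraic S x := by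
  let i : S →+* Subfield.closure (S : Set K) :=
    Subring.inclusion (T := (Subfield.closure (S : Set K)).toSubring) Subfield.subset_closure
  let _ : Algebra S (Subfield.closure (S : Set K)) := i.toAlgebra
  have : IsScalarTower S (Subfield.closure (S : Set K)) K := IsScalarTower.of_algebraMap_eq' rfl
  have : Algebra.IsAlgebraic S (Subfield.closure (S : Set K)) := by
    constructor
    rintro ⟨y, hy⟩
    rw [← isAlgebraic_algebraMap_iff
      (algebraMap (Subfield.closure (S : Set K)) K).injective]
    change IsAlgebraic S y
    induction hy using Subfield.closure_induction with
    | mem y hy => exact isAlgebraic_algebraMap (⟨y, hy⟩ : S)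
    | one => exact isAlgebraic_one
    | add y z _ _ hy hz => exact hy.add hz
    | neg y _ hy => exact hy.neg
    | inv y _ hy => exact hy.inv
    | mul y z _ _ hy hz => exact hy.mul hz
  exact h.restrictScalars S

/-- Denominators are cleared so that all coefficients are values of `φ`, with the top one nonzero.
-/
theorem exists_relation_of_isAlgebraic_closure_range {G K : Type*} [CommRing G] [Field K]
    (φ : G →+* K) {x : K} (h : IsAlgebraic (Subfield.closure (Set.range φ)) x) :
    ∃ (n : ℕ) (g : ℕ → G), φ (g n) ≠ 0 ∧ ∑ t ∈ Finset.range (n + 1), φ (g t) * x ^ t = 0 := by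
  rw [← RingHom.coe_range] at h
  obtain ⟨p, hp0, hp⟩ := isAlgebraic_of_isAlgebraic_closure φ.range h
  choose g hg using fun t => (p.coeff t).2
  refine ⟨p.natDegree, g, fun h0 => hp0 (Polynomial.leadingCoeff_eq_zero.1 (Subtype.ext ?_)), ?_⟩
  · rw [Polynomial.leadingCoeff, ← hg, h0]
    rfl
  · rw [Polynomial.aeval_eq_sum_range] at hp
    rw [← hp]
    refine Finset.sum_congr rfl fun t _ => ?_
    rw [Algebra.smul_def, hg]
    rfl

theorem isAlgebraic_subfield_mono {K : Type*} [Field K] {F F' : Subfield K} (hF : F ≤ F') {x : K}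
    (h : IsAlgebraic F x) : IsAlgebraic F' x := by
  let _ : Algebra F F' := (Subfield.inclusion hF).toAlgebra
  have : IsScalarTower F F' K := IsScalarTower.of_algebraMap_eq' rfl
  exact h.extendScalars (algebraMap F F').injective

/-- An embedding of a field extends to an extension field, with prescribed algebraically independent
values on a transcendence basis. -/
theorem exists_extension_of_isTranscendenceBasis {F E L : Type*} [Field F] [Field E] [Field L]
    [Algebra F E] [Algebra F L] [IsAlgClosed L] {ι : Type*} {b : ι → E}
    (hb : IsTranscendenceBasis F b) {w : ι → L} (hw : AlgebraicIndependent F w) :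
    ∃ J : E →+* L, (∀ x, J (algebraMap F E x) = algebraMap F L x) ∧ ∀ i, J (b i) = w i := by
  let A := Algebra.adjoin F (Set.range b)
  let g : A →ₐ[F] L := (MvPolynomial.aeval w).comp hb.1.aevalEquiv.symm.toAlgHom
  have hg : Function.Injective g :=
    (algebraicIndependent_iff_injective_aeval.1 hw).comp hb.1.aevalEquiv.symm.injective
  let _ : Algebra A L := g.toRingHom.toAlgebra
  have : FaithfulSMul A L := (faithfulSMul_iff_algebraMap_injective A L).2 hg
  have := hb.isAlgebraic
  let J : E →ₐ[A] L := IsAlgClosed.lift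
  refine ⟨J, fun x => ?_, fun i => ?_⟩
  · exact (J.commutes (algebraMap F A x)).trans (g.commutes x)
  · have h1 := J.commutes (⟨b i, Algebra.subset_adjoin ⟨i, rfl⟩⟩ : A)
    refine h1.trans ?_
    change MvPolynomial.aeval w (hb.1.aevalEquiv.symm ⟨b i, _⟩) = w i
    have h2 : hb.1.aevalEquiv (MvPolynomial.X i) = ⟨b i, Algebra.subset_adjoin ⟨i, rfl⟩⟩ := by
      refine Subtype.ext ?_
      have := hb.1.algebraMap_aevalEquiv (MvPolynomial.X i)
      rw [MvPolynomial.aeval_X] at this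
      exact this
    rw [← h2, AlgEquiv.symm_apply_apply, MvPolynomial.aeval_X]

/-- Lets one independent value be moved infinitely close to a prescribed point without losing
independence. -/
theorem algebraicIndependent_affine {K A : Type*} [Field K] [CommRing A] [Algebra K A] {ι : Type*}
    {y : ι → A} (hy : AlgebraicIndependent K y) (c d : ι → K) (hd : ∀ i, d i ≠ 0) :
    AlgebraicIndependent K fun i => algebraMap K A (c i) + algebraMap K A (d i) * y i := by
  have h := hy.polynomial_aeval_of_transcendental (f := fun i => C (c i) + C (d i) * X) fun i => by
    have h1 : (C (c i) + C (d i) * X : K[X]).natDegree ≠ 0 := by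
      rw [add_comm, natDegree_linear (hd i)]
      exact one_ne_zero
    have := (transcendental_X K).aeval (C (c i) + C (d i) * X) h1
    rw [aeval_X_left_apply] at this
    refine this (mem_nonZeroDivisors_of_ne_zero (leadingCoeff_ne_zero.2 fun h => h1 ?_))
    rw [h, natDegree_zero]
  simpa using h

variable {D : Ultrafilter Nat.Primes}

theorem exists_algebraicIndependent_complex (K : Subfield ℂ) [Countable K] :
    ∃ (X : Set ℂ), AlgebraicIndependent K ((↑) : X → ℂ) ∧ Cardinal.mk X = Cardinal.continuum := by
  obtain ⟨X, hX⟩ := exists_isTranscendenceBasis K ℂ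
  refine ⟨X, hX.1, ?_⟩
  have := IsAlgClosed.cardinal_eq_cardinal_transcendence_basis_of_aleph0_lt' _ hX
    (Cardinal.mk_le_aleph0_iff.2 inferInstance) (by
      rw [Cardinal.mk_complex]
      exact Cardinal.aleph0_lt_continuum)
  rw [← this, Cardinal.mk_complex]

/-- An embedding into the ultrapower of a countable field extends to any field of cardinality at
most the continuum, and a transcendental element can be sent infinitely close to any `z`. -/
theorem exists_extension_starC (hD : (D : Filter Nat.Primes) ≤ Filter.cofinite) {E : Type}
    [Field E] (hE : Cardinal.mk E ≤ Cardinal.continuum) (F : Subfield E) (I : F →+* StarC D)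
    (K : Subfield ℂ) [Countable K] (hI : ∀ x, I x ∈ starSubfield D K) {z : ℂ} (hz : z ∈ K)
    {x₀ : E} (hx₀ : Transcendental F x₀ ∨ ∃ x : F, x₀ = x ∧ I x = stdC D z) :
    ∃ J : E →+* StarC D, (∀ x : F, J x = I x) ∧ Near (J x₀) z := by
  classical
  let _ : Algebra F (StarC D) := I.toAlgebra
  let _ : Algebra F (starSubfield D K) := (I.codRestrict (starSubfield D K) hI).toAlgebra
  have : IsScalarTower F (starSubfield D K) (StarC D) := IsScalarTower.of_algebraMap_eq' rfl
  obtain ⟨X, hX, hXc⟩ := exists_algebraicIndependent_complex K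
  obtain ⟨B, hB₀, hB⟩ : ∃ B : Set E, (Transcendental F x₀ → x₀ ∈ B) ∧
      IsTranscendenceBasis F ((↑) : B → E) := by
    by_cases h : Transcendental F x₀
    · obtain ⟨B, h1, h2⟩ := exists_isTranscendenceBasis_superset (R := F) (s := {x₀})
        ((algebraicIndependent_unique_type_iff (x := fun i : ({x₀} : Set E) => id (i : E))).2 h)
      exact ⟨B, fun _ => h1 rfl, h2⟩
    · obtain ⟨B, hB⟩ := exists_isTranscendenceBasis F E
      exact ⟨B, fun h' => absurd h' h, hB⟩
  obtain ⟨φ⟩ : Nonempty (B ↪ X) :=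
    Cardinal.le_def _ _ |>.1 (((Cardinal.mk_set_le B).trans hE).trans_eq hXc.symm)
  have hδ : (starC D fun k => ((k : ℕ) : ℂ)⁻¹) ∈ starSubfield D K :=
    ⟨_, fun k => inv_mem (natCast_mem K _), rfl⟩
  have hz' : stdC D z ∈ starSubfield D K := ⟨_, fun _ => hz, rfl⟩
  -- If `x₀` is in the basis it goes to `z + δ y` with `δ = 1/q` at the prime `q`; the other basis
  -- elements go to standard numbers `y`. Independence is proved over `*K`, which contains the image
  -- of `F`.
  have hw : AlgebraicIndependent F fun b : B =>
      algebraMap (starSubfield D K) (StarC D) (if (b : E) = x₀ then ⟨_, hz'⟩ else 0) +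
      algebraMap (starSubfield D K) (StarC D) (if (b : E) = x₀ then ⟨_, hδ⟩ else 1) *
        stdC D (φ b) := by
    refine AlgebraicIndependent.restrictScalars (K := starSubfield D K)
      (algebraMap F (starSubfield D K)).injective ?_
    refine algebraicIndependent_affine (y := fun b => stdC D (φ b))
      (algebraicIndependent_stdC (hX.comp φ φ.injective)) _ _ fun b => ?_
    split_ifs
    · intro h
      obtain ⟨k, hk⟩ := ((starC_eq_iff (y := fun _ => 0)).1 (congrArg Subtype.val h)).exists
      exact inv_ne_zero (Nat.cast_ne_zero.2 k.2.ne_zero) hk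
    · exact one_ne_zero
  obtain ⟨J, hJ, hJ'⟩ := exists_extension_of_isTranscendenceBasis hB hw
  refine ⟨J, hJ, ?_⟩
  rcases hx₀ with h | ⟨x, rfl, hx⟩
  · have h1 := hJ' ⟨x₀, hB₀ h⟩
    rw [if_pos rfl, if_pos rfl] at h1
    rw [h1]
    -- `δ` is infinitesimal because `D` is non-principal.
    have h2 : Near (starC D fun k => ((k : ℕ) : ℂ)⁻¹) 0 := by
      refine near_starC_iff.2 (tendsto_inv₀_cobounded.comp ?_)
      rw [← tendsto_norm_atTop_iff_cobounded]
      simp only [Complex.norm_natCast]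
      refine tendsto_natCast_atTop_atTop.comp ?_
      rw [← Nat.cofinite_eq_atTop]
      exact (Subtype.val_injective.tendsto_cofinite).mono_left hD
    have h3 := (Near.std z).add (h2.mul (Near.std (D := D) (φ ⟨x₀, hB₀ h⟩ : ℂ)))
    rw [zero_mul, add_zero] at h3
    exact h3
  · have h1 := hJ x
    change J x = I x at h1
    rw [h1, hx]
    exact Near.std z

end PseudoFinite

namespace PseudoFinite

open Polynomial

namespace Params

variable {D : Ultrafilter Nat.Primes} {P : Params D}

/-! ### Transcendence of `i` and `j` -/

theorem Admissible.transcendental_int_red_i (hP : P.Admissible)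
    (hi : starZ D P.i ^ 2 + 1 ≠ starZ D P.p) : Transcendental ℤ (P.red P.i) := by
  rw [transcendental_iff]
  intro p hp
  by_contra hp0
  -- A standard polynomial is bounded by a constant function in `ℱ`; its coefficients are listed
  -- from the leading one down.
  refine hP.i_generic hi _ (P.natCast_mem_funs (coeffSize Int.natAbs p)) p.natDegree
    (fun t _ => p.coeff (p.natDegree - t)) (fun t => ?_) (fun h => ?_) ?_
  · have := IsSize.natAbs.le_coeffSize p (p.natDegree - t)
    have h1 : -(coeffSize Int.natAbs p : ℤ) ≤ p.coeff (p.natDegree - t) := by omega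
    have h2 : p.coeff (p.natDegree - t) ≤ (coeffSize Int.natAbs p : ℤ) := by omega
    exact ⟨starZ_le_iff (x := fun _ => -(coeffSize Int.natAbs p : ℤ)).2
      (Eventually.of_forall fun _ => h1),
      starZ_le_iff (y := fun _ => (coeffSize Int.natAbs p : ℤ)).2
      (Eventually.of_forall fun _ => h2)⟩
  · obtain ⟨k, hk⟩ := (starZ_eq_iff (y := fun _ => 0).1 h).exists
    exact hp0 (leadingCoeff_eq_zero.1 hk)
  · rw [← hp, aeval_eq_sum_range, Fin.sum_univ_eq_sum_range (fun t =>
      P.red (fun _ => p.coeff (p.natDegree - t)) * P.red P.i ^ (p.natDegree - t)),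
      ← Finset.sum_range_reflect]
    refine Finset.sum_congr rfl fun t ht => ?_
    have h1 : p.natDegree - (p.natDegree + 1 - 1 - t) = t := by
      have := Finset.mem_range.1 ht
      omega
    rw [h1, zsmul_eq_mul, ← red_intCast]
    rfl

theorem Admissible.red_j_sq (hP : P.Admissible) : P.red P.j ^ 2 = P.red P.i := by
  rw [← redHom_apply, ← map_pow, redHom_apply]
  refine P.red_eq_red_iff.2 ?_
  filter_upwards [hP.eventually_regular] with k hk
  rw [Pi.pow_apply, hk.j_sq, sub_self]
  exact dvd_zero _

/-- If `j` were algebraic over `F`, so would be `i = j²`. Clearing denominators gives a relation in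
powers of `i` whose coefficients are values of bounded polynomials, and all of these must vanish,
the leading one included. -/
theorem Admissible.transcendental_red_j (hP : P.Admissible)
    (hi : starZ D P.i ^ 2 + 1 ≠ starZ D P.p) : Transcendental P.F (P.red P.j) := by
  intro h
  have h1 := h.pow 2
  rw [hP.red_j_sq] at h1
  obtain ⟨n, g, hg, h2⟩ := exists_relation_of_isAlgebraic_closure_range
    (P.evalF.comp (boundedSubring hP).subtype) (isAlgebraic_subfield_mono hP.F_le_fracField h1)
  exact hg ((hP.evalF_eq_zero_iff (g n).2).2
    (hP.dvd_of_sum_evalF_eq_zero (Or.inr (hP.transcendental_int_red_i hi))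
      (Q := fun t => (g t).1) (T := n + 1) (fun t _ => (g t).2) h2 n n.lt_succ_self))

/-! ### Elements of `F` -/

theorem IsEmbeddingIF.exists_apply_eq {I : P.F →+* StarC D} (hI : P.IsEmbeddingIF I)
    {a s : Nat.Primes → ℤ} (ha : starZ D a ∈ P.OFun) (hs : starZ D s ∈ P.OL) :
    ∃ x : P.F, (x : P.Fp) = P.red a * P.expP (fun k => s k * P.v k) ∧
      I x = starC D fun k => (a k : ℂ) * P.zeta k ^ s k := by
  let A : Family := ⟨fun _ => {0}, fun k _ => a k, fun _ _ => 0, fun k _ => s k⟩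
  have hA : P.Good A := by
    refine ⟨⟨0, Eventually.of_forall fun k => by simp [A]⟩, fun t _ => ⟨ha, ⟨0, ?_, ?_⟩, hs⟩⟩
    · exact starZ_le_iff (x := fun k => -(0 * P.l k)).2 (Eventually.of_forall fun k => by simp [A])
    · exact starZ_le_iff (y := fun k => 0 * P.l k).2 (Eventually.of_forall fun k => by simp [A])
  refine ⟨⟨_, P.sumF_mem A hA⟩, ?_, (hI A hA).trans ?_⟩
  · change P.sumF A = _
    rw [expP, ← redHom_apply, ← redHom_apply, ← map_mul, redHom_apply, sumF]
    congr 1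
    funext k
    simp [A, expCoord]
  · rw [sumC]
    congr 1
    funext k
    simp [A, zeta_zpow]

theorem IsEmbeddingIF.exists_apply_eq_intCast {I : P.F →+* StarC D} (hI : P.IsEmbeddingIF I)
    {a : Nat.Primes → ℤ} (ha : starZ D a ∈ P.OFun) :
    ∃ x : P.F, I x = starC D fun k => (a k : ℂ) := by
  obtain ⟨x, -, hx⟩ := hI.exists_apply_eq ha (s := fun _ => 0) ⟨0,
    starZ_le_iff (x := fun k => -(0 * P.l k)).2 (Eventually.of_forall fun k => by simp),
    starZ_le_iff (y := fun k => 0 * P.l k).2 (Eventually.of_forall fun k => by simp)⟩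
  exact ⟨x, by simpa using hx⟩

/-- As `n ∣ l`, the internal exponent `l / n` yields standard roots of unity exactly, not just up to
an infinitesimal. -/
theorem Admissible.exists_apply_root (hP : P.Admissible) {I : P.F →+* StarC D}
    (hI : P.IsEmbeddingIF I) {n : ℕ} (hn : 0 < n) :
    ∃ x : P.F, (x : P.Fp) = P.expP (fun k => P.l k / n * P.v k) ∧
      I x = stdC D (Complex.exp (-(2 * Real.pi * Complex.I / n))) := by
  obtain ⟨x, hx, hx'⟩ := hI.exists_apply_eq (a := fun _ => 1) (s := fun k => P.l k / n)
    ⟨1, P.one_mem_funs, starZ_le_iff (x := fun _ => -1) (y := fun _ => 1).2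
      (Eventually.of_forall fun _ => by norm_num), le_refl _⟩
    ⟨1, starZ_le_iff (x := fun k => -(1 * P.l k)).2 (by
      filter_upwards [hP.eventually_regular] with k hk
      have := Int.ediv_nonneg hk.l_pos.le (Nat.cast_nonneg n)
      have := hk.l_pos
      omega), starZ_le_iff (y := fun k => 1 * P.l k).2 (by
      filter_upwards [hP.eventually_regular] with k hk
      rw [one_mul]
      exact Int.ediv_le_self _ hk.l_pos.le)⟩
  refine ⟨x, hx.trans ?_, hx'.trans (starC_eq_iff.2 ?_)⟩
  · have : P.red (fun _ => 1) = 1 := map_one P.redHom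
    rw [this, one_mul]
  · filter_upwards [hP.eventually_regular, hP.dvd_l hn] with k hk hk'
    have hl : (P.l k : ℂ) ≠ 0 := by exact_mod_cast hk.l_pos.ne'
    have hn' : (n : ℂ) ≠ 0 := by exact_mod_cast hn.ne'
    have h1 : ((P.l k / n : ℤ) : ℂ) * n = P.l k := by
      exact_mod_cast congrArg (Int.cast : ℤ → ℂ) (Int.ediv_mul_cancel hk')
    rw [zeta_zpow, Int.cast_one, one_mul, ← h1]
    have h2 : ((P.l k / n : ℤ) : ℂ) ≠ 0 := fun h => hl (by rw [← h1, h, zero_mul])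
    congr 1
    field_simp

/-! ### Standard parts attained on `F`, and the size of `F` and `F_p` -/

theorem Admissible.tendsto_l (hP : P.Admissible) :
    Tendsto (fun k => (P.l k : ℝ)) (D : Filter Nat.Primes) atTop := by
  refine tendsto_atTop.2 fun C => ?_
  filter_upwards [hP.le_l ⌈C⌉₊] with k hk
  exact (Nat.le_ceil C).trans (by exact_mod_cast hk)

theorem Admissible.exists_apply_l (hP : P.Admissible) {I : P.F →+* StarC D}
    (hI : P.IsEmbeddingIF I) : ∃ x : P.F, I x = starC D fun k => (P.l k : ℂ) := by
  refine hI.exists_apply_eq_intCast ⟨id, P.id_mem_funs, ?_, le_refl _⟩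
  refine starZ_le_iff (x := fun k => -P.l k).2 ?_
  filter_upwards [hP.eventually_regular] with k hk
  have := hk.l_pos
  omega

/-- The approximating element is `⌊a l⌋ / l`; its error is at most `1 / l`, an infinitesimal. -/
theorem Admissible.exists_near_real (hP : P.Admissible) {I : P.F →+* StarC D}
    (hI : P.IsEmbeddingIF I) (a : ℝ) : ∃ x : P.F, Near (I x) a := by
  obtain ⟨y, hy⟩ := hP.exists_apply_l hI
  obtain ⟨x, hx⟩ := hI.exists_apply_eq_intCast (a := fun k => ⌊a * P.l k⌋)
    ⟨_, P.mul_mem_funs (P.natCast_mem_funs (⌈|a|⌉₊ + 1)) P.id_mem_funs, by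
      refine starZ_le_iff (x := fun k => -((⌈|a|⌉₊ + 1 : ℕ) * P.l k)).2 ?_
      filter_upwards [hP.eventually_regular] with k hk
      rw [Int.le_floor]
      push_cast
      have h1 := Nat.le_ceil |a|
      have h2 := neg_abs_le a
      have h3 : (0 : ℝ) < P.l k := by exact_mod_cast hk.l_pos
      nlinarith, by
      refine starZ_le_iff (y := fun k => ((⌈|a|⌉₊ + 1 : ℕ) * P.l k)).2 ?_
      filter_upwards [hP.eventually_regular] with k hk
      have h0 := Int.floor_le (a * P.l k)
      rw [← Int.cast_le (R := ℝ)]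
      push_cast
      have h1 := Nat.le_ceil |a|
      have h2 := le_abs_self a
      have h3 : (0 : ℝ) < P.l k := by exact_mod_cast hk.l_pos
      nlinarith⟩
  refine ⟨x / y, ?_⟩
  rw [map_div₀, hx, hy]
  refine (near_starC_iff (x := fun k => (⌊a * P.l k⌋ : ℂ) / (P.l k : ℂ))).2 ?_
  have h1 : Tendsto (fun k => (⌊a * P.l k⌋ : ℝ) / (P.l k : ℝ)) D (𝓝 a) := by
    have h2 : Tendsto (fun k => a - (P.l k : ℝ)⁻¹) D (𝓝 a) := by
      simpa using (tendsto_const_nhds (x := a)).sub (tendsto_inv_atTop_zero.comp hP.tendsto_l)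
    refine tendsto_of_tendsto_of_tendsto_of_le_of_le' h2 tendsto_const_nhds ?_ ?_
    · filter_upwards [hP.eventually_regular] with k hk
      have h3 : (0 : ℝ) < P.l k := by exact_mod_cast hk.l_pos
      rw [le_div_iff₀ h3, sub_mul, inv_mul_cancel₀ h3.ne']
      exact (Int.sub_one_lt_floor _).le
    · filter_upwards [hP.eventually_regular] with k hk
      have h3 : (0 : ℝ) < P.l k := by exact_mod_cast hk.l_pos
      rw [div_le_iff₀ h3]
      exact Int.floor_le _
  have h2 := (Complex.continuous_ofReal.tendsto a).comp h1
  refine h2.congr fun k => ?_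
  simp

theorem exp_neg_two_pi_div_four :
    Complex.exp (-(2 * Real.pi * Complex.I / (4 : ℕ))) = -Complex.I := by
  have : -(2 * Real.pi * Complex.I / ((4 : ℕ) : ℂ)) = -(Real.pi / 2 * Complex.I) := by
    push_cast
    ring
  rw [this, Complex.exp_neg, Complex.exp_pi_div_two_mul_I, Complex.inv_I]

theorem Admissible.exists_near (hP : P.Admissible) {I : P.F →+* StarC D}
    (hI : P.IsEmbeddingIF I) (c : ℂ) : ∃ x : P.F, Near (I x) c := by
  obtain ⟨x, hx⟩ := hP.exists_near_real hI c.re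
  obtain ⟨y, hy⟩ := hP.exists_near_real hI c.im
  -- This root of unity is sent to `-i`, hence the sign in the witness below.
  obtain ⟨w, -, hw⟩ := hP.exists_apply_root hI four_pos
  rw [exp_neg_two_pi_div_four] at hw
  refine ⟨x + -(y * w), ?_⟩
  rw [map_add, map_neg, map_mul, hw]
  have := hx.add (hy.mul (Near.std (D := D) (-Complex.I))).neg
  convert this using 1
  rw [mul_neg, neg_neg, Complex.re_add_im]

theorem Admissible.exists_st_eq_infty (hP : P.Admissible) {I : P.F →+* StarC D}
    (hI : P.IsEmbeddingIF I) : ∃ x : P.F, st (I x) = OnePoint.infty := by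
  obtain ⟨y, hy⟩ := hP.exists_apply_l hI
  refine ⟨y, st_eq_infty ?_⟩
  rintro ⟨c, hc⟩
  rw [hy, near_starC_iff] at hc
  refine not_tendsto_nhds_of_tendsto_atTop (tendsto_abs_atTop_atTop.comp hP.tendsto_l) ‖c‖ ?_
  refine hc.norm.congr fun k => ?_
  simp

/-- There are only countably many primes, hence countably many `ζ_k` and `E_k`; with `z` they
generate a countable field in which all coordinates of the defining sums lie. -/
theorem IsEmbeddingIF.exists_countable_subfield {I : P.F →+* StarC D}
    (hI : P.IsEmbeddingIF I) (z : ℂ) : ∃ K : Subfield ℂ, Countable K ∧ z ∈ K ∧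
      ∀ x, I x ∈ starSubfield D K := by
  let S : Set ℂ := {z} ∪ (Set.range P.zeta ∪ Set.range P.expReal)
  have hS : S.Countable :=
    (Set.countable_singleton z).union ((Set.countable_range _).union (Set.countable_range _))
  have hSK : ∀ {w}, w ∈ S → w ∈ Subfield.closure S := fun h => Subfield.subset_closure h
  refine ⟨Subfield.closure S, ?_, hSK (Or.inl rfl), ?_⟩
  · rw [← Cardinal.mk_le_aleph0_iff]
    exact (Subfield.cardinalMk_closure_le_max S).trans
      (max_le (Cardinal.mk_le_aleph0_iff.2 hS.to_subtype) le_rfl)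
  · have h : P.F ≤ ((starSubfield D (Subfield.closure S)).comap I).map P.F.subtype := by
      refine Subfield.closure_le.2 ?_
      rintro _ ⟨A, hA, rfl⟩
      refine ⟨⟨_, P.sumF_mem A hA⟩, ?_, rfl⟩
      change I _ ∈ starSubfield D _
      rw [hI A hA]
      refine ⟨_, fun k => ?_, rfl⟩
      refine sum_mem fun t _ => mul_mem (mul_mem (intCast_mem _ _) ?_) ?_
      · rw [← expReal_zpow]
        exact zpow_mem (hSK (Or.inr (Or.inr ⟨k, rfl⟩))) _
      · rw [← zeta_zpow]
        exact zpow_mem (hSK (Or.inr (Or.inl ⟨k, rfl⟩))) _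
    intro x
    obtain ⟨y, hy, hxy⟩ := h x.2
    rwa [← Subtype.ext hxy]

theorem mk_Fp_le : Cardinal.mk P.Fp ≤ Cardinal.continuum := by
  refine (Cardinal.mk_le_of_surjective P.redHom_surjective).trans ?_
  rw [Cardinal.mk_arrow, Cardinal.lift_id, Cardinal.lift_id, Cardinal.mk_eq_aleph0 ℤ]
  exact (Cardinal.power_le_power_left Cardinal.aleph0_ne_zero Cardinal.mk_le_aleph0).trans_eq
    Cardinal.aleph0_power_aleph0

/-- Here `(p - 1) / 8 = (l / 8) v`, so the normalisation exhibits `j` as the inverse of an eighth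
root of unity in `F` that is sent to `exp(-2πi/8)`. -/
theorem Admissible.red_j_eq (hP : P.Admissible) (hi : starZ D P.i ^ 2 + 1 = starZ D P.p)
    {I : P.F →+* StarC D} (hI : P.IsEmbeddingIF I) :
    ∃ x : P.F, P.red P.j = x ∧ I x = stdC D (Complex.exp (Real.pi * Complex.I / 4)) := by
  obtain ⟨x, hx, hx'⟩ := hP.exists_apply_root hI (n := 8) (by norm_num)
  have h1 := hP.normal hi (fun k => P.l k / (8 : ℕ) * P.v k) (by
    refine starZ_eq_iff (x := fun k => 8 * (P.l k / (8 : ℕ) * P.v k))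
      (y := fun k => P.p k - 1).2 ?_
    filter_upwards [hP.eventually_regular, hP.dvd_l (n := 8) (by norm_num)] with k hk hk'
    have h2 := Int.ediv_mul_cancel hk'
    rw [← hk.v_mul]
    conv_rhs => rw [← h2]
    push_cast
    ring)
  rw [← hx] at h1
  refine ⟨x⁻¹, eq_inv_of_mul_eq_one_right h1, ?_⟩
  rw [map_inv₀, hx']
  refine inv_eq_of_mul_eq_one_right (starC_eq_iff (x := fun _ => _) (y := fun _ => 1).2
    (Eventually.of_forall fun k => ?_))
  change Complex.exp _ * Complex.exp _ = 1
  rw [← Complex.exp_add, Complex.exp_eq_one_iff]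
  refine ⟨0, ?_⟩
  push_cast
  ring

end Params

end PseudoFinite
-- Assembly of the embedding and the place
theorem mainTheorem5 (D : Ultrafilter Nat.Primes)
    (hD : (D : Filter Nat.Primes) ≤ Filter.cofinite)
    (P : PseudoFinite.Params D) (hP : P.Admissible) :
    (∃! I : P.F →+* PseudoFinite.StarC D, P.IsEmbeddingIF I) ∧
    ∀ I : P.F →+* PseudoFinite.StarC D, P.IsEmbeddingIF I →
      ∃ i' : PseudoFinite.StarC D,
        PseudoFinite.Infinitesimal (i' - PseudoFinite.stdC D Complex.I) ∧
        ∃ J : P.Fp →+* PseudoFinite.StarC D,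
          Function.Injective J ∧
          (∀ x : P.F, J x = I x) ∧
          J (P.red P.i) = i' ∧
          PseudoFinite.IsPlace (fun x : P.Fp => PseudoFinite.st (J x)) ∧
          Function.Surjective (fun x : P.Fp => PseudoFinite.st (J x)) ∧
          PseudoFinite.st (J (P.red P.i)) =
            ((Complex.exp (Real.pi * Complex.I / 2) : ℂ) : OnePoint ℂ) ∧
          PseudoFinite.st (J (P.red P.j)) =
            ((Complex.exp (Real.pi * Complex.I / 4) : ℂ) : OnePoint ℂ) := by
  refine ⟨?_, fun I hI => ?_⟩
  · obtain ⟨I, hI⟩ := hP.exists_isEmbeddingIF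
    exact ⟨I, hI, fun I' hI' => hI'.unique hI⟩
  obtain ⟨K, hK, hzK, hIK⟩ :=
    hI.exists_countable_subfield (Complex.exp (Real.pi * Complex.I / 4))
  -- Only the value at `j` is prescribed; the standard part at `i` follows by squaring.
  obtain ⟨J, hJ, hJj⟩ := PseudoFinite.exists_extension_starC hD
    PseudoFinite.Params.mk_Fp_le P.F I K hIK hzK (x₀ := P.red P.j) (by
      by_cases hi : PseudoFinite.starZ D P.i ^ 2 + 1 = PseudoFinite.starZ D P.p
      · exact Or.inr (hP.red_j_eq hi hI)
      · exact Or.inl (hP.transcendental_red_j hi))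
  have hJi : PseudoFinite.Near (J (P.red P.i)) (Complex.exp (Real.pi * Complex.I / 2)) := by
    rw [← hP.red_j_sq, sq, map_mul]
    have h := hJj.mul hJj
    rw [← Complex.exp_add] at h
    convert h using 2
    ring
  have hI' : Complex.exp (Real.pi * Complex.I / 2) = Complex.I := by
    rw [mul_div_right_comm, Complex.exp_pi_div_two_mul_I]
  -- Elements of `F` already reach every complex number, so surjectivity does not depend on the
  -- chosen extension.
  have hnear : ∀ c : ℂ, ∃ x, PseudoFinite.Near (J x) c := fun c => by
    obtain ⟨x, hx⟩ := hP.exists_near hI c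
    exact ⟨x, by rwa [hJ]⟩
  refine ⟨J (P.red P.i), ?_, J, J.injective, hJ, rfl, PseudoFinite.isPlace_st_comp J hnear,
    fun c => ?_, hJi.st_eq, hJj.st_eq⟩
  · rw [← hI']
    exact hJi
  · induction c using OnePoint.rec with
    | infty =>
      obtain ⟨x, hx⟩ := hP.exists_st_eq_infty hI
      exact ⟨x, by simp only [hJ, hx]⟩
    | coe c =>
      obtain ⟨x, hx⟩ := hnear c
      exact ⟨x, hx.st_eq⟩
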